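/- Let $\xi$ be a periodic Gaussian spatial white noise on $\mathbf R$ of period $L\in(0,\infty)$, i.e. a random distribution on $\mathbf R$, defined on some probability space, such that $(\xi(\varphi))_{\varphi\in C_c^\infty(\mathbf R)}$ is a centred Gaussian process with $$\mathbf E[\xi(\varphi)\xi(\psi)]=\sum_{k\in\mathbf Z}\int_{\mathbf R}\varphi(x)\psi(x+kL)\,dx .$$ Let $\rho\in C_c^\infty(\mathbf R)$ with $\int\rho=1$, put $\rho_\varepsilon(x)=\varepsilon^{-1}\rho(\varepsilon^{-1}x)$ and $\xi_\varepsilon=\rho_\varepsilon*\xi$ for $\varepsilon>0$, and $\xi_0=\xi$. Let $G:\mathbf R\setminus\{0\}\to\mathbf R$ be smooth and even, with $\operatorname{supp}G\subset[-1,1]$ and $G(x)=\frac1\pi\log|x|$ for $0<|x|\le\frac12$. For $\varepsilon\ge0$ let $S_\varepsilon=-G*\xi_\varepsilon$. For $\alpha\in(0,1)$ let $\mathcal C^\alpha$ be the space of functions $u:\mathbf R\to\mathbf R$ with finite norm $$\|u\|_{\mathcal C^\alpha}=\|u\|_{L^\infty}+\sup_{0<|x-y|\le1}\frac{|u(x)-u(y)|}{|x-y|^\alpha}.$$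 Let $0<\kappa<\frac12$. Then for every $\varepsilon\ge0$, almost surely, the distribution $S_\varepsilon$ is a continuous function, the principal value $$\Xi_\varepsilon w(x)=\frac1\pi\,\mathrm{p.v.}\!\int_{\mathbf R}\frac{(e^{S_\varepsilon(y)-S_\varepsilon(x)}-1)(w(y)-w(x))}{(y-x)^2}\,dy=\frac1\pi\lim_{\delta\downarrow0}\int_{\mathbf R\setminus[x-\delta,x+\delta]}\frac{(e^{S_\varepsilon(y)-S_\varepsilon(x)}-1)(w(y)-w(x))}{(y-x)^2}\,dy$$ exists for all $w\in\mathcal C^{1/2+\kappa}$ and all $x\in\mathbf R$, and $\Xi_\varepsilon$ is a bounded linear operator from $\mathcal C^{1/2+\kappa}$ to $L^\infty(\mathbf R)$. Moreover, with $\Xi=\Xi_0$, $$\|\Xi_\varepsilon-\Xi\|_{\mathcal C^{1/2+\kappa}\to L^\infty}\longrightarrow0\quad\text{in probability as }\varepsilon\downarrow0 .$$ -/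

import Mathlib

open MeasureTheory ProbabilityTheory Filter Topology Set TopologicalSpace
open scoped ENNReal Distributions Convolution

noncomputable section

/-! ### Hölder spaces -/

/-- The difference quotient `|u x - u y| / |x - y| ^ α`; it is `0` on the diagonal. -/
def holderQuot (α : ℝ) (u : ℝ → ℝ) (p : ℝ × ℝ) : ℝ :=
  |u p.1 - u p.2| / |p.1 - p.2| ^ α

/-- The pairs of points over which the Hölder seminorm takes its supremum. -/
abbrev NearPairs : Type := {p : ℝ × ℝ // |p.1 - p.2| ≤ 1}

theorem holderQuot_nonneg (α : ℝ) (u : ℝ → ℝ) (p : ℝ × ℝ) : 0 ≤ holderQuot α u p := by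
  unfold holderQuot; positivity

theorem holderQuot_add_le (α : ℝ) (u v : ℝ → ℝ) (p : ℝ × ℝ) :
    holderQuot α (u + v) p ≤ holderQuot α u p + holderQuot α v p := by
  unfold holderQuot
  rw [← add_div]
  gcongr
  have : (u + v) p.1 - (u + v) p.2 = (u p.1 - u p.2) + (v p.1 - v p.2) := by
    simp only [Pi.add_apply]; ring
  rw [this]
  exact abs_add_le _ _

theorem holderQuot_smul (α c : ℝ) (u : ℝ → ℝ) (p : ℝ × ℝ) :
    holderQuot α (c • u) p = |c| * holderQuot α u p := by
  unfold holderQuot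
  have : (c • u) p.1 - (c • u) p.2 = c * (u p.1 - u p.2) := by
    simp only [Pi.smul_apply, smul_eq_mul]; ring
  rw [this, abs_mul, mul_div_assoc]

/-- Bounded functions on the line with bounded difference quotients of order `α` over pairs of
points at distance at most one. -/
def holderSubmodule (α : ℝ) : Submodule ℝ (ℝ → ℝ) where
  carrier := {u | BddAbove (range fun x => |u x|) ∧
    BddAbove (range fun p : NearPairs => holderQuot α u p.1)}
  add_mem' := by
    rintro u v ⟨⟨A, hA⟩, ⟨B, hB⟩⟩ ⟨⟨A', hA'⟩, ⟨B', hB'⟩⟩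
    refine ⟨⟨A + A', ?_⟩, ⟨B + B', ?_⟩⟩
    · rintro _ ⟨x, rfl⟩
      exact (abs_add_le _ _).trans (add_le_add (hA ⟨x, rfl⟩) (hA' ⟨x, rfl⟩))
    · rintro _ ⟨p, rfl⟩
      exact (holderQuot_add_le α u v p.1).trans (add_le_add (hB ⟨p, rfl⟩) (hB' ⟨p, rfl⟩))
  zero_mem' := by
    refine ⟨⟨0, ?_⟩, ⟨0, ?_⟩⟩
    · rintro _ ⟨x, rfl⟩; simp
    · rintro _ ⟨p, rfl⟩; simp [holderQuot]
  smul_mem' := by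
    rintro c u ⟨⟨A, hA⟩, ⟨B, hB⟩⟩
    refine ⟨⟨|c| * A, ?_⟩, ⟨|c| * B, ?_⟩⟩
    · rintro _ ⟨x, rfl⟩
      simp only [Pi.smul_apply, smul_eq_mul, abs_mul]
      exact mul_le_mul_of_nonneg_left (hA ⟨x, rfl⟩) (abs_nonneg c)
    · rintro _ ⟨p, rfl⟩
      simp only [holderQuot_smul]
      exact mul_le_mul_of_nonneg_left (hB ⟨p, rfl⟩) (abs_nonneg c)

/-- The Hölder space `C^α` of the real line, for `0 < α < 1`. -/
def HolderSpace (α : ℝ) : Type := ↥(holderSubmodule α)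

namespace HolderSpace

variable {α : ℝ}

instance : AddCommGroup (HolderSpace α) := inferInstanceAs (AddCommGroup ↥(holderSubmodule α))

instance : Module ℝ (HolderSpace α) := inferInstanceAs (Module ℝ ↥(holderSubmodule α))

instance : CoeFun (HolderSpace α) fun _ => ℝ → ℝ := ⟨Subtype.val⟩

/-- `‖u‖ = sup |u| + sup_{|x - y| ≤ 1} |u x - u y| / |x - y| ^ α`. -/
instance : Norm (HolderSpace α) :=
  ⟨fun u => (⨆ x, |u x|) + ⨆ p : NearPairs, holderQuot α u p.1⟩

theorem norm_def (u : HolderSpace α) :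
    ‖u‖ = (⨆ x, |u x|) + ⨆ p : NearPairs, holderQuot α u p.1 := rfl

theorem normCore (α : ℝ) : NormedSpace.Core ℝ (HolderSpace α) where
  norm_nonneg u := add_nonneg (Real.iSup_nonneg fun _ => abs_nonneg _)
    (Real.iSup_nonneg fun _ => holderQuot_nonneg _ _ _)
  norm_smul c u := by
    have h : ((c • u : HolderSpace α) : ℝ → ℝ) = c • (u : ℝ → ℝ) := rfl
    simp only [norm_def, h, holderQuot_smul, Pi.smul_apply, smul_eq_mul, abs_mul,
      Real.norm_eq_abs]
    rw [← Real.mul_iSup_of_nonneg (abs_nonneg c), ← Real.mul_iSup_of_nonneg (abs_nonneg c),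
      mul_add]
  norm_triangle u v := by
    have h : ((u + v : HolderSpace α) : ℝ → ℝ) = (u : ℝ → ℝ) + (v : ℝ → ℝ) := rfl
    have : Nonempty NearPairs := ⟨⟨(0, 0), by simp⟩⟩
    simp only [norm_def, h]
    have h1 : (⨆ x, |((u : ℝ → ℝ) + (v : ℝ → ℝ)) x|) ≤ (⨆ x, |u x|) + ⨆ x, |v x| :=
      ciSup_le fun x => (abs_add_le _ _).trans
        (add_le_add (le_ciSup u.2.1 x) (le_ciSup v.2.1 x))
    have h2 : (⨆ p : NearPairs, holderQuot α ((u : ℝ → ℝ) + (v : ℝ → ℝ)) p.1) ≤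
        (⨆ p : NearPairs, holderQuot α u p.1) + ⨆ p : NearPairs, holderQuot α v p.1 :=
      ciSup_le fun p => (holderQuot_add_le _ _ _ _).trans
        (add_le_add (le_ciSup u.2.2 p) (le_ciSup v.2.2 p))
    linarith
  norm_eq_zero_iff u := by
    constructor
    · intro h
      have h0 : 0 ≤ ⨆ x, |u x| := Real.iSup_nonneg fun _ => abs_nonneg _
      have h1 : 0 ≤ ⨆ p : NearPairs, holderQuot α u p.1 :=
        Real.iSup_nonneg fun _ => holderQuot_nonneg _ _ _
      rw [norm_def] at h
      refine Subtype.ext (funext fun x => ?_)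
      have h2 : |u x| ≤ ⨆ x, |u x| := le_ciSup u.2.1 x
      have h3 : |u x| ≤ 0 := by linarith
      exact abs_nonpos_iff.mp h3
    · rintro rfl
      have h : ((0 : HolderSpace α) : ℝ → ℝ) = 0 := rfl
      simp [norm_def, h, holderQuot]

instance : NormedAddCommGroup (HolderSpace α) := NormedAddCommGroup.ofCore (normCore α)

instance : NormedSpace ℝ (HolderSpace α) := NormedSpace.ofCore (normCore α)

end HolderSpace

/-! ### Distributions on the line -/

/-- Smooth compactly supported test functions on the line. -/
abbrev TestFn : Type := 𝓓((⊤ : Opens ℝ), ℝ)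

/-- The convolution `f ⋆ φ` of a compactly supported integrable function with a test function,
again a test function. -/
def convTest (f : ℝ → ℝ) (hf : Integrable f) (hc : HasCompactSupport f) (φ : TestFn) :
    TestFn where
  toFun := f ⋆ φ
  contDiff' := φ.hasCompactSupport.contDiff_convolution_right _ hf.locallyIntegrable φ.contDiff
  hasCompactSupport' := hc.convolution _ φ.hasCompactSupport
  tsupport_subset' := fun _ _ => trivial

/-- The convolution `f * T` of a compactly supported integrable function with a distribution:
`(f * T)(φ) = T (y ↦ ∫ f (x - y) φ x dx)`. -/
def convDistrib (f : ℝ → ℝ) (hf : Integrable f) (hc : HasCompactSupport f) (T : TestFn → ℝ) :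
    TestFn → ℝ :=
  fun φ => T (convTest (fun x => f (-x)) hf.comp_neg
    (hc.comp_homeomorph (Homeomorph.neg ℝ)) φ)

/-- The distribution `T` is given by integration against the continuous function `s`. -/
def IsGivenBy (T : TestFn → ℝ) (s : ℝ → ℝ) : Prop :=
  Continuous s ∧ ∀ φ : TestFn, T φ = ∫ x, s x * φ x

/-! ### Noise, mollification, approximate Green's function -/

/-- `ξ` is a periodic Gaussian white noise of period `L`: a random distribution that is a centred
Gaussian process indexed by test functions, with covariance kernel `∑ₖ δ(x - y + k L)`. -/
structure IsPeriodicWhiteNoise {Ω : Type*} [MeasurableSpace Ω] (P : Measure Ω) (L : ℝ)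
    (ξ : Ω → 𝓓'((⊤ : Opens ℝ), ℝ)) : Prop where
  gaussian : IsGaussianProcess (fun (φ : TestFn) (ω : Ω) => ξ ω φ) P
  centred : ∀ φ : TestFn, ∫ ω, ξ ω φ ∂P = 0
  covariance : ∀ φ ψ : TestFn,
    ∫ ω, ξ ω φ * ξ ω ψ ∂P = ∑' k : ℤ, ∫ x, φ x * ψ (x + k * L)

/-- `ρ_ε(x) = ε⁻¹ ρ(ε⁻¹ x)`. -/
def rescale (ρ : TestFn) (ε : ℝ) (x : ℝ) : ℝ := ε⁻¹ * ρ (ε⁻¹ * x)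

theorem hasCompactSupport_rescale (ρ : TestFn) {ε : ℝ} (hε : 0 < ε) :
    HasCompactSupport (rescale ρ ε) :=
  (ρ.hasCompactSupport.comp_homeomorph
    (Homeomorph.mulLeft₀ ε⁻¹ (inv_ne_zero hε.ne'))).mul_left

theorem integrable_rescale (ρ : TestFn) {ε : ℝ} (hε : 0 < ε) : Integrable (rescale ρ ε) :=
  Continuous.integrable_of_hasCompactSupport
    (continuous_const.mul (ρ.continuous.comp (continuous_const.mul continuous_id)))
    (hasCompactSupport_rescale ρ hε)

/-- `T_ε = ρ_ε * T` for `ε > 0`, and `T_0 = T`. -/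
def mollify (ρ : TestFn) (T : TestFn → ℝ) (ε : ℝ) : TestFn → ℝ :=
  open Classical in
  if hε : 0 < ε then
    convDistrib (rescale ρ ε) (integrable_rescale ρ hε) (hasCompactSupport_rescale ρ hε) T
  else T

/-- `G` is an approximate Green's function of the half-Laplacian: it is even, smooth away from
the origin, supported in `[-1, 1]`, and equal to `(1/π) log |x|` near the origin.
The value of `G` at the origin is irrelevant. -/
structure IsApproxGreen (G : ℝ → ℝ) : Prop where
  smooth : ContDiffOn ℝ ((⊤ : ℕ∞) : WithTop ℕ∞) G {0}ᶜ
  even : ∀ x, G (-x) = G x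
  support : tsupport G ⊆ Icc (-1) 1
  log : ∀ x, x ≠ 0 → |x| ≤ 1 / 2 → G x = 1 / Real.pi * Real.log |x|

namespace IsApproxGreen

variable {G : ℝ → ℝ}

theorem hasCompactSupport (hG : IsApproxGreen G) : HasCompactSupport G :=
  isCompact_Icc.of_isClosed_subset (isClosed_tsupport G) hG.support

theorem integrable (hG : IsApproxGreen G) : Integrable G := by
  have hcont : ContinuousOn G {0}ᶜ := hG.smooth.continuousOn
  have h1 : IntegrableOn G (Icc (-1) (-(1 / 2))) :=
    (hcont.mono fun x hx => by
      simp only [mem_compl_iff, mem_singleton_iff]; rintro rfl; norm_num at hx).integrableOn_Icc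
  have h3 : IntegrableOn G (Icc (1 / 2) 1) :=
    (hcont.mono fun x hx => by
      simp only [mem_compl_iff, mem_singleton_iff]; rintro rfl; norm_num at hx).integrableOn_Icc
  have h2 : IntegrableOn G (Icc (-(1 / 2)) (1 / 2)) := by
    have hlog : IntegrableOn (fun x => 1 / Real.pi * Real.log x) (Icc (-(1 / 2)) (1 / 2)) := by
      rw [integrableOn_Icc_iff_integrableOn_Ioc,
        ← intervalIntegrable_iff_integrableOn_Ioc_of_le (by norm_num)]
      exact intervalIntegral.intervalIntegrable_log'.const_mul _
    refine hlog.congr_fun_ae ?_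
    have hne : ∀ᵐ x : ℝ ∂(volume.restrict (Icc (-(1 / 2)) (1 / 2))), x ≠ 0 :=
      ae_restrict_of_ae (by simp [ae_iff])
    filter_upwards [hne, ae_restrict_mem measurableSet_Icc] with x hx hx2
    rw [hG.log x hx (abs_le.mpr ⟨by linarith [hx2.1], hx2.2⟩), Real.log_abs]
  have h : IntegrableOn G (Icc (-1) 1) := by
    refine ((h1.union h2).union h3).mono_set fun x hx => ?_
    rcases le_total x (-(1 / 2)) with h | h
    · exact Or.inl (Or.inl ⟨hx.1, h⟩)
    · rcases le_total x (1 / 2) with h' | h'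
      · exact Or.inl (Or.inr ⟨h, h'⟩)
      · exact Or.inr ⟨h', hx.2⟩
  exact (integrableOn_iff_integrable_of_support_subset
    ((subset_tsupport G).trans hG.support)).mp h

end IsApproxGreen

/-- The distribution `S_ε = -G * ξ_ε`, where `ξ_ε = ρ_ε * ξ` for `ε > 0` and `ξ_0 = ξ`. -/
def distribS {G : ℝ → ℝ} (hG : IsApproxGreen G) (ρ : TestFn) (ξ : 𝓓'((⊤ : Opens ℝ), ℝ))
    (ε : ℝ) : TestFn → ℝ :=
  fun φ => -convDistrib G hG.integrable hG.hasCompactSupport (mollify ρ (fun ψ => ξ ψ) ε) φ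

/-! ### The nonlocal operator -/

/-- The principal value of `∫ g` at the point `x` exists and equals `a`. -/
def HasPrincipalValue (g : ℝ → ℝ) (x a : ℝ) : Prop :=
  (∀ δ > 0, IntegrableOn g (Icc (x - δ) (x + δ))ᶜ) ∧
    Tendsto (fun δ => ∫ y in (Icc (x - δ) (x + δ))ᶜ, g y) (𝓝[>] 0) (𝓝 a)

/-- `T` is the bounded operator `C^α → L^∞` given by
`T w (x) = (1/π) p.v. ∫ (exp (s y - s x) - 1) (w y - w x) / (y - x)² dy`,
where the principal values exist for every `w` and every `x`. -/
def IsXiOperator {α : ℝ} (s : ℝ → ℝ)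
    (T : HolderSpace α →L[ℝ] Lp ℝ ∞ (volume : Measure ℝ)) : Prop :=
  ∀ w : HolderSpace α, ∃ I : ℝ → ℝ,
    (∀ x, HasPrincipalValue
      (fun y => (Real.exp (s y - s x) - 1) * (w y - w x) / (y - x) ^ 2) x (I x)) ∧
    (T w : ℝ → ℝ) =ᵐ[volume] fun x => 1 / Real.pi * I x

end

/-! The field `-G * ξ` is almost surely bounded and Hölder of every order `β < 1/2`; everything
after that is deterministic. Put `α = 1/2 + κ` and choose `γ < β < 1/2` with `α + γ > 1`. The kernel
`exp (s y - s x) - 1` is then of order `|x - y| ^ γ` and the increment of `w` of order `|x - y| ^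
α`. The integrand is thus dominated by `|x - y| ^ (α + γ - 2)` near the diagonal and by `|x - y| ^
(-2)` away from it. The integral converges absolutely, and no cancellation in the principal value is
used (`KernelBound.abs_singularIntegrand_le`, `KernelBound.exists_isSingularOperator`).

Regularity: the logarithmic singularity makes `∫ (G (z + h) - G z) ^ 2` at most of order `|h| ^ (2 *
θ)` for every `θ < 1/2`. By the covariance formula this bounds the variance of increments, hence all
even moments, the noise being Gaussian. To work with genuine functions, `G` is first mollified at
scale `1 / n`; the moment bounds are uniform in `n` by Jensen. By Fatou the `liminf` of the energies
of dyadic increments is almost surely finite, so along a subsequence depending on `ω` the mollified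
fields share one Hölder bound. Arzelà–Ascoli gives a limit, identified through its pairings with
test functions (`exists_holderBound_field`).

Convergence: on the same event `S_ε = ρ_ε * S` for all `ε > 0`, so `S_ε` has the Hölder bound of `S`
up to the factor `∫ |ρ|` and lies within order `ε ^ β` of `S` uniformly. Interpolation gives
distance of order `ε ^ (β - γ)` in the `γ`-seminorm, hence in operator norm, with a random constant
(`HolderBound.abs_sub_sub_le`, `IsSingularOperator.norm_sub_le`). This implies convergence in
probability. -/

noncomputable section

/-! ### Distributions acting on superpositions of test functions -/

/-- The `i`-th derivative of a test function supported in `K`, as a bounded continuous function. -/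
def derivBCF (K : Compacts ℝ) (i : ℕ) : 𝓓_{K}(ℝ, ℝ) →L[ℝ] BoundedContinuousFunction ℝ ℝ :=
  (ContinuousLinearMap.compLeftContinuousBounded ℝ
    ((ContinuousMultilinearMap.piFieldEquiv ℝ (Fin i) ℝ).symm.toContinuousLinearEquiv :
      (ℝ [×i]→L[ℝ] ℝ) →L[ℝ] ℝ)).comp (ContDiffMapSupportedIn.structureMapCLM ℝ ⊤ i)

theorem derivBCF_apply {K : Compacts ℝ} (i : ℕ) (f : 𝓓_{K}(ℝ, ℝ)) (y : ℝ) :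
    derivBCF K i f y = iteratedDeriv i f y := by
  have h : derivBCF K i f y = (ContinuousMultilinearMap.piFieldEquiv ℝ (Fin i) ℝ).symm
    (ContDiffMapSupportedIn.structureMapCLM ℝ ⊤ i f y) := rfl
  rw [h, ContDiffMapSupportedIn.structureMapCLM_top_apply, iteratedDeriv_eq_equiv_comp]
  rfl

theorem seminorm_le_norm_derivBCF {K : Compacts ℝ} (i : ℕ) (f : 𝓓_{K}(ℝ, ℝ)) :
    ContDiffMapSupportedIn.seminorm ℝ ℝ ℝ ⊤ K i f ≤ ‖derivBCF K i f‖ := by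
  rw [ContDiffMapSupportedIn.seminorm_top_le_iff ℝ (norm_nonneg _)]
  intro x _
  rw [norm_iteratedFDeriv_eq_norm_iteratedDeriv, ← derivBCF_apply]
  exact (derivBCF K i f).norm_coe_le_norm x

/-- Continuity bounds `T` by finitely many sup norms of derivatives, so `T` factors through the
range of `f ↦ (f⁽ⁱ⁾)` in a Banach space, and Hahn–Banach extends it from there. Bochner integration
can then take place in that Banach space. -/
theorem exists_clm_comp_derivBCF {K : Compacts ℝ} (T : 𝓓_{K}(ℝ, ℝ) →L[ℝ] ℝ) :
    ∃ (s : Finset ℕ) (Λ : StrongDual ℝ (s → BoundedContinuousFunction ℝ ℝ)),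
      ∀ f, T f = Λ fun i => derivBCF K i f := by
  obtain ⟨s, C, -, hC⟩ := Seminorm.bound_of_continuous
    (ContDiffMapSupportedIn.withSeminorms ℝ ℝ ℝ ⊤ K)
    ((normSeminorm ℝ ℝ).comp (T : 𝓓_{K}(ℝ, ℝ) →ₗ[ℝ] ℝ)) (by
      change Continuous fun f => ‖T f‖
      fun_prop)
  have hC0 : ∀ f, ‖T f‖ ≤ C * (s.sup fun i => ContDiffMapSupportedIn.seminorm ℝ ℝ ℝ ⊤ K i) f :=
    fun f => hC f
  let J : 𝓓_{K}(ℝ, ℝ) →ₗ[ℝ] (s → BoundedContinuousFunction ℝ ℝ) :=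
    LinearMap.pi fun i => (derivBCF K (i : ℕ)).toLinearMap
  have hbound : ∀ f, ‖T f‖ ≤ C * ‖J f‖ := by
    intro f
    refine (hC0 f).trans (mul_le_mul_of_nonneg_left ?_ C.2)
    refine Seminorm.finset_sup_apply_le (norm_nonneg _) fun i hi => ?_
    exact (seminorm_le_norm_derivBCF i f).trans (norm_le_pi_norm (J f) ⟨i, hi⟩)
  have hker : LinearMap.ker J ≤ LinearMap.ker (T : 𝓓_{K}(ℝ, ℝ) →ₗ[ℝ] ℝ) := by
    intro f hf
    have h := hbound f
    rw [LinearMap.mem_ker.mp hf, norm_zero, mul_zero] at h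
    exact LinearMap.mem_ker.mpr (norm_le_zero_iff.mp h)
  let e := J.quotKerEquivRange
  let g : LinearMap.range J →ₗ[ℝ] ℝ :=
    ((LinearMap.ker J).liftQ (T : 𝓓_{K}(ℝ, ℝ) →ₗ[ℝ] ℝ) hker) ∘ₗ (e.symm : _ →ₗ[ℝ] _)
  have hg : ∀ f, g ⟨J f, LinearMap.mem_range_self J f⟩ = T f := by
    intro f
    have : e.symm ⟨J f, LinearMap.mem_range_self J f⟩ = (LinearMap.ker J).mkQ f := by
      rw [LinearEquiv.symm_apply_eq]; rfl
    simp only [g, LinearMap.comp_apply, LinearEquiv.coe_coe, this]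
    rfl
  have hgb : ∀ v, ‖g v‖ ≤ C * ‖v‖ := by
    rintro ⟨_, f, rfl⟩
    rw [hg f]
    exact hbound f
  obtain ⟨Λ, hΛ, -⟩ := exists_extension_norm_eq (LinearMap.range J) (g.mkContinuous C hgb)
  refine ⟨s, Λ, fun f => ?_⟩
  have := hΛ ⟨J f, LinearMap.mem_range_self J f⟩
  rw [← hg f]
  exact this.symm

/-- The Bochner integral commutes with the Hahn–Banach extension, and point evaluations identify its
components with the derivatives of `F`. -/
theorem clm_eq_integral_of_curve {K : Compacts ℝ} (T : 𝓓_{K}(ℝ, ℝ) →L[ℝ] ℝ)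
    {γ : ℝ → 𝓓_{K}(ℝ, ℝ)} (hγ : Continuous γ) (hc : HasCompactSupport γ) (F : 𝓓_{K}(ℝ, ℝ))
    (hF : ∀ (i : ℕ) (y : ℝ), iteratedDeriv i F y = ∫ x, iteratedDeriv i (γ x) y) :
    T F = ∫ x, T (γ x) := by
  obtain ⟨s, Λ, hΛ⟩ := exists_clm_comp_derivBCF T
  simp_rw [hΛ]
  let c : ℝ → (s → BoundedContinuousFunction ℝ ℝ) := fun x i => derivBCF K i (γ x)
  have hcc : Continuous c := continuous_pi fun i => (derivBCF K i).continuous.comp hγ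
  have hcs : HasCompactSupport c := by
    refine hc.mono fun x hx h => hx ?_
    funext i
    simp [c, h]
  have hint : Integrable c := hcc.integrable_of_hasCompactSupport hcs
  rw [show (∫ x, Λ fun i => derivBCF K i (γ x)) = ∫ x, Λ (c x) from rfl,
    Λ.integral_comp_comm hint]
  congr 1
  funext i
  ext1 y
  have h2 := ((BoundedContinuousFunction.evalCLM ℝ y).comp (ContinuousLinearMap.proj (R := ℝ)
    (φ := fun _ : s => BoundedContinuousFunction ℝ ℝ) i)).integral_comp_comm hint
  refine Eq.trans ?_ h2
  rw [derivBCF_apply, hF]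
  exact integral_congr_ae (ae_of_all _ fun x => (derivBCF_apply i (γ x) y).symm)

/-! ### Translates of test functions -/

/-- The translate `y ↦ φ (y - a)`. -/
def shiftTest (a : ℝ) (φ : TestFn) : TestFn where
  toFun y := φ (y - a)
  contDiff' := φ.contDiff.comp (contDiff_id.sub contDiff_const)
  hasCompactSupport' := φ.hasCompactSupport.comp_homeomorph (Homeomorph.subRight a)
  tsupport_subset' := fun _ _ => trivial

@[simp] theorem shiftTest_apply (a : ℝ) (φ : TestFn) (y : ℝ) : shiftTest a φ y = φ (y - a) := rfl

theorem integrable_testFn (φ : TestFn) : Integrable φ :=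
  φ.continuous.integrable_of_hasCompactSupport φ.hasCompactSupport

theorem convTest_apply (f : ℝ → ℝ) (hf : Integrable f) (hc : HasCompactSupport f) (φ : TestFn)
    (y : ℝ) : convTest f hf hc φ y = ∫ x, f x * φ (y - x) := rfl

theorem iteratedDeriv_convolution_right {f g : ℝ → ℝ} (hf : LocallyIntegrable f)
    (hg : ContDiff ℝ ((⊤ : ℕ∞) : WithTop ℕ∞) g) (hcg : HasCompactSupport g) (i : ℕ) :
    iteratedDeriv i (f ⋆ g : ℝ → ℝ) = (f ⋆ iteratedDeriv i g : ℝ → ℝ) := by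
  induction i generalizing g with
  | zero => simp
  | succ i ih =>
    have hd : deriv (f ⋆ g : ℝ → ℝ) = (f ⋆ deriv g : ℝ → ℝ) := by
      funext x
      exact (hcg.hasDerivAt_convolution_right _ hf (hg.of_le (by exact_mod_cast le_top)) x).deriv
    rw [iteratedDeriv_succ', iteratedDeriv_succ', hd]
    exact ih ((contDiff_infty_iff_deriv.mp hg).2) hcg.deriv

open scoped Pointwise in
/-- The Minkowski sum of the supports of two test functions. -/
def supportSum (φ g : TestFn) : Compacts ℝ :=
  ⟨tsupport g + tsupport φ, g.hasCompactSupport.isCompact.add φ.hasCompactSupport.isCompact⟩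

open scoped Pointwise in
/-- The curve `x ↦ φ x • g (· - x)` in the space of test functions supported in a fixed compact
set. -/
def smulShift (φ g : TestFn) (x : ℝ) :
    𝓓_{supportSum φ g}(ℝ, ℝ) :=
  ContDiffMapSupportedIn.of_support_subset (f := fun y => φ x * g (y - x))
    (contDiff_const.mul (shiftTest x g).contDiff) (by
      intro y hy
      have h1 : φ x ≠ 0 := fun h => hy (by simp [h])
      have h2 : g (y - x) ≠ 0 := fun h => hy (by simp [h])
      exact ⟨y - x, subset_tsupport _ h2, x, subset_tsupport _ h1, by simp⟩)

theorem smulShift_apply (φ g : TestFn) (x y : ℝ) : smulShift φ g x y = φ x * g (y - x) := rfl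

theorem iteratedDeriv_smulShift (φ g : TestFn) (x y : ℝ) (i : ℕ) :
    iteratedDeriv i (smulShift φ g x) y = φ x * iteratedDeriv i g (y - x) := by
  have : (smulShift φ g x : ℝ → ℝ) = fun y => φ x * g (y - x) := rfl
  rw [this, iteratedDeriv_const_mul_field, iteratedDeriv_comp_sub_const]

open scoped Pointwise in
theorem continuous_smulShift (φ g : TestFn) : Continuous (smulShift φ g) := by
  rw [ContDiffMapSupportedIn.continuous_iff_comp]
  intro i
  have hgi : Continuous (iteratedDeriv i g) := g.contDiff.continuous_iteratedDeriv i
    (by exact_mod_cast le_top)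
  set u : ℝ × ℝ → ℝ := fun p => φ p.1 * iteratedDeriv i g (p.2 - p.1) with hu
  have huc : Continuous u := by fun_prop
  have hus : HasCompactSupport u := by
    have hgs : HasCompactSupport (iteratedDeriv i g) := by
      rw [iteratedDeriv_eq_equiv_comp]
      exact (g.hasCompactSupport.iteratedFDeriv i).comp_left (map_zero _)
    have h := φ.hasCompactSupport.isCompact.prod
      ((hgs.isCompact).add φ.hasCompactSupport.isCompact)
    refine HasCompactSupport.intro h fun p hp => ?_
    by_contra hne
    have h1 : φ p.1 ≠ 0 := fun h => hne (by simp [hu, h])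
    have h2 : iteratedDeriv i g (p.2 - p.1) ≠ 0 := fun h => hne (by simp [hu, h])
    exact hp ⟨subset_tsupport _ h1, p.2 - p.1, subset_tsupport _ h2, p.1,
      subset_tsupport _ h1, by simp⟩
  -- Uniform continuity of `u` on the plane makes the estimate in `x` uniform in `y`, which is
  -- convergence of the `i`-th derivative in sup norm.
  have huu : UniformContinuous u := hus.uniformContinuous_of_continuous huc
  rw [Metric.continuous_iff]
  intro x ε hε
  obtain ⟨δ, hδ, h⟩ := Metric.uniformContinuous_iff.mp huu (ε / 2) (half_pos hε)
  refine ⟨δ, hδ, fun x' hx' => lt_of_le_of_lt ?_ (half_lt_self hε)⟩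
  refine (BoundedContinuousFunction.dist_le (half_pos hε).le).mpr fun y => ?_
  simp only [Function.comp_apply, ContDiffMapSupportedIn.structureMapCLM_top_apply,
    iteratedFDeriv_eq_equiv_comp, LinearIsometryEquiv.dist_map, iteratedDeriv_smulShift]
  exact (h (a := (x', y)) (b := (x, y)) (by simpa [Prod.dist_eq, hδ] using hx')).le

open scoped Pointwise in
/-- A distribution commutes with superposition: `ξ (φ ⋆ g) = ∫ φ x ξ (g (· - x)) dx`. -/
theorem distribution_convTest (ξ : 𝓓'((⊤ : Opens ℝ), ℝ)) (φ g : TestFn) :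
    ξ (convTest φ (integrable_testFn φ) φ.hasCompactSupport g) =
      ∫ x, φ x * ξ (shiftTest x g) := by
  set K : Compacts ℝ := supportSum φ g
  let T : 𝓓_{K}(ℝ, ℝ) →L[ℝ] ℝ :=
    { toFun := fun f => ξ (TestFunction.ofSupportedIn (Ω := (⊤ : Opens ℝ)) (fun _ _ => trivial) f)
      map_add' := fun f g => by rw [← map_add]; rfl
      map_smul' := fun c g => by rw [← map_smul]; rfl
      cont := ξ.continuous.comp (TestFunction.continuous_ofSupportedIn _) }
  let F : 𝓓_{K}(ℝ, ℝ) := ContDiffMapSupportedIn.of_support_subset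
    (convTest φ (integrable_testFn φ) φ.hasCompactSupport g).contDiff (by
      refine (support_convolution_subset_swap (L := ContinuousLinearMap.lsmul ℝ ℝ)
        (f := φ) (g := g) (μ := volume)).trans ?_
      exact Set.add_subset_add (subset_tsupport _) (subset_tsupport _))
  have h := clm_eq_integral_of_curve T (continuous_smulShift φ g) (by
      refine φ.hasCompactSupport.mono fun x hx h => hx ?_
      ext y
      simp [smulShift_apply, h]) F (by
    intro i y
    refine Eq.trans ?_
      (integral_congr_ae (ae_of_all _ fun x => (iteratedDeriv_smulShift φ g x y i).symm))
    have h1 : (F : ℝ → ℝ) = (φ ⋆ g : ℝ → ℝ) := rfl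
    rw [h1, iteratedDeriv_convolution_right
      (integrable_testFn φ).locallyIntegrable g.contDiff g.hasCompactSupport, convolution_def]
    rfl)
  refine h.trans (integral_congr_ae (ae_of_all _ fun x => ?_))
  change ξ _ = φ x * ξ _
  rw [← smul_eq_mul, ← map_smul]
  rfl

theorem continuous_distribution_shiftTest (ξ : 𝓓'((⊤ : Opens ℝ), ℝ)) (g : TestFn) :
    Continuous fun x => ξ (shiftTest x g) := by
  rw [continuous_iff_continuousAt]
  intro x₀
  -- The translates have no common compact support. Multiplying by a cutoff equal to one near `x₀`
  -- gives the curve `smulShift`, which agrees with them locally.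
  let b : ContDiffBump x₀ := ⟨1, 2, one_pos, one_lt_two⟩
  let φ : TestFn := ⟨b, b.contDiff, b.hasCompactSupport, fun _ _ => trivial⟩
  have h1 : Continuous fun x => ξ (TestFunction.ofSupportedIn (Ω := (⊤ : Opens ℝ))
      (fun _ _ => trivial) (smulShift φ g x)) :=
    ξ.continuous.comp ((TestFunction.continuous_ofSupportedIn _).comp (continuous_smulShift φ g))
  refine h1.continuousAt.congr ?_
  filter_upwards [Metric.ball_mem_nhds x₀ one_pos] with x hx
  congr 1
  ext y
  change φ x * g (y - x) = g (y - x)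
  rw [show φ x = 1 from b.one_of_mem_closedBall (Metric.ball_subset_closedBall hx), one_mul]

/-! ### Uniformly bounded Hölder functions -/

/-- `s` is bounded by `A`, and its increments over distances at most one are bounded by
`A * |x - y| ^ β`. -/
structure HolderBound (β A : ℝ) (s : ℝ → ℝ) : Prop where
  bound : ∀ x, |s x| ≤ A
  holder : ∀ x y, |x - y| ≤ 1 → |s x - s y| ≤ A * |x - y| ^ β

namespace HolderBound

variable {β A : ℝ} {s : ℝ → ℝ}

theorem nonneg (h : HolderBound β A s) : 0 ≤ A := (abs_nonneg _).trans (h.bound 0)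

theorem mono {B : ℝ} (h : HolderBound β A s) (hAB : A ≤ B) : HolderBound β B s :=
  ⟨fun x => (h.bound x).trans hAB, fun x y hxy => (h.holder x y hxy).trans (by gcongr)⟩

theorem exists_modulus (β A : ℝ) (hβ : 0 < β) {ε : ℝ} (hε : 0 < ε) :
    ∃ δ > 0, ∀ s, HolderBound β A s → ∀ x y, |x - y| < δ → |s x - s y| < ε := by
  have h0 : Tendsto (fun t : ℝ => A * |t| ^ β) (𝓝 0) (𝓝 0) := by
    have hc : Continuous fun t : ℝ => A * |t| ^ β :=
      continuous_const.mul (continuous_abs.rpow_const fun _ => Or.inr hβ.le)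
    simpa [Real.zero_rpow hβ.ne'] using hc.tendsto 0
  obtain ⟨δ, hδ, h⟩ := Metric.eventually_nhds_iff.mp (h0.eventually_lt_const hε)
  refine ⟨min δ 1, lt_min hδ one_pos, fun s hs x y hxy => ?_⟩
  refine (hs.holder x y (hxy.le.trans (min_le_right _ _))).trans_lt (h ?_)
  simpa using hxy.trans_le (min_le_left _ _)

theorem continuous (hβ : 0 < β) (h : HolderBound β A s) : Continuous s := by
  rw [Metric.continuous_iff]
  intro x ε hε
  obtain ⟨δ, hδ, hs⟩ := exists_modulus β A hβ hε
  exact ⟨δ, hδ, fun y hy => hs s h y x hy⟩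

/-- The topology on `C(ℝ, ℝ)` is that of locally uniform convergence. The bounds are closed under
pointwise limits and themselves force continuity, so the set is closed in a product of intervals,
and it is equicontinuous. -/
theorem isCompact_setOf (hβ : 0 < β) (A : ℝ) :
    IsCompact {f : C(ℝ, ℝ) | HolderBound β A f} := by
  refine ArzelaAscoli.isCompact_of_equicontinuous _ ?_ ?_
  · have himg : ContinuousMap.toFun '' {f : C(ℝ, ℝ) | HolderBound β A f} =
        {f : ℝ → ℝ | HolderBound β A f} := by
      ext f
      constructor
      · rintro ⟨g, hg, rfl⟩; exact hg
      · intro hf; exact ⟨⟨f, hf.continuous hβ⟩, hf, rfl⟩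
    rw [himg]
    refine (isCompact_univ_pi fun _ : ℝ => isCompact_Icc (a := -A) (b := A)).of_isClosed_subset
      ?_ fun f hf x _ => abs_le.mp (hf.bound x)
    have hset : {f : ℝ → ℝ | HolderBound β A f} = (⋂ x, {f : ℝ → ℝ | |f x| ≤ A}) ∩
        ⋂ x, ⋂ y, ⋂ (_ : |x - y| ≤ 1), {f : ℝ → ℝ | |f x - f y| ≤ A * |x - y| ^ β} := by
      ext f
      simp only [mem_inter_iff, mem_iInter, mem_ofPred_eq]
      exact ⟨fun h => ⟨h.1, h.2⟩, fun h => ⟨h.1, h.2⟩⟩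
    rw [hset]
    refine (isClosed_iInter fun x => isClosed_le (by fun_prop) continuous_const).inter
      (isClosed_iInter fun x => isClosed_iInter fun y => isClosed_iInter fun _ =>
        isClosed_le (by fun_prop) continuous_const)
  · intro x
    rw [Metric.equicontinuousAt_iff]
    intro ε hε
    obtain ⟨δ, hδ, hs⟩ := exists_modulus β A hβ hε
    refine ⟨δ, hδ, fun y hy f => ?_⟩
    exact hs f.1 f.2 x y (by rwa [← Real.dist_eq, dist_comm])

/-- A functional which is the limit of integrals against functions that frequently satisfy a fixed
Hölder bound is given by a function with this Hölder bound. -/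
theorem exists_of_tendsto_integral (hβ : 0 < β) {T : TestFn → ℝ} {S : ℕ → ℝ → ℝ}
    (hT : ∀ φ : TestFn, Tendsto (fun n => ∫ x, S n x * φ x) atTop (𝓝 (T φ)))
    (hS : ∃ᶠ n in atTop, HolderBound β A (S n)) :
    ∃ s, HolderBound β A s ∧ ∀ φ : TestFn, T φ = ∫ x, s x * φ x := by
  obtain ⟨u, hu, hSu⟩ := extraction_of_frequently_atTop hS
  obtain ⟨s, hs, v, hv, hlim⟩ := (isCompact_setOf hβ A).tendsto_subseq
    (x := fun n => (⟨S (u n), (hSu n).continuous hβ⟩ : C(ℝ, ℝ))) hSu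
  refine ⟨s, hs, fun φ => ?_⟩
  -- The pairings converge along the full sequence, so any subsequential limit represents `T`.
  have hT' := (hT φ).comp (hu.comp hv).tendsto_atTop
  refine tendsto_nhds_unique hT' ?_
  refine tendsto_integral_of_dominated_convergence (fun x => A * |φ x|)
    (fun n => (((hSu (v n)).continuous hβ).mul φ.continuous).aestronglyMeasurable)
    ((integrable_testFn φ).abs.const_mul A) (fun n => ae_of_all _ fun x => ?_)
    (ae_of_all _ fun x => ?_)
  · simp only [Function.comp_apply, Real.norm_eq_abs, abs_mul]
    exact mul_le_mul_of_nonneg_right ((hSu (v n)).bound x) (abs_nonneg _)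
  · have h1 : Tendsto (fun n => S (u (v n)) x) atTop (𝓝 (s x)) :=
      ((continuous_eval_const x).tendsto s).comp hlim
    exact h1.mul_const _

end HolderBound

/-! ### Chaining over dyadic points -/

theorem tendsto_floor_two_pow_mul_div (x : ℝ) :
    Tendsto (fun n : ℕ => (⌊2 ^ n * x⌋ : ℝ) / 2 ^ n) atTop (𝓝 x) := by
  have h1 : Tendsto (fun n : ℕ => x - (1 / 2 : ℝ) ^ n) atTop (𝓝 x) := by
    simpa using (tendsto_pow_atTop_nhds_zero_of_lt_one (r := (1 / 2 : ℝ)) (by norm_num)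
      (by norm_num)).const_sub x
  refine tendsto_of_tendsto_of_tendsto_of_le_of_le h1 tendsto_const_nhds (fun n => ?_) fun n => ?_
  · have h2 : (0 : ℝ) < 2 ^ n := by positivity
    have h3 := Int.lt_floor_add_one (2 ^ n * x)
    simp only
    rw [le_div_iff₀ h2, sub_mul, ← mul_pow]
    norm_num
    linarith
  · have h2 : (0 : ℝ) < 2 ^ n := by positivity
    simp only
    rw [div_le_iff₀ h2]
    linarith [Int.floor_le (2 ^ n * x)]

/-- The constant in the dyadic chaining bound. -/
def chainConst (β : ℝ) : ℝ := (2 / (1 - 2 ^ (-β)) + 1) * 2 ^ β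

theorem chainConst_nonneg {β : ℝ} (hβ : 0 < β) : 0 ≤ chainConst β := by
  have : (2 : ℝ) ^ (-β) < 1 := Real.rpow_lt_one_of_one_lt_of_neg one_lt_two (neg_lt_zero.mpr hβ)
  have : 0 < 1 - (2 : ℝ) ^ (-β) := by linarith
  unfold chainConst
  positivity

/-- Each point is joined to its dyadic floor of generation `n` by a telescoping geometric series. If
`2 ^ (-n)` is comparable to `|x - y|`, the floors of `x` and `y` coincide or are neighbours. -/
theorem abs_sub_le_of_dyadic {β A : ℝ} (hβ : 0 < β) {g : ℝ → ℝ} (hg : Continuous g)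
    (h : ∀ (n : ℕ) (k : ℤ), |g ((k + 1) / 2 ^ n) - g (k / 2 ^ n)| ≤ A * (2 ^ (-β)) ^ n)
    (x y : ℝ) (hxy : |x - y| ≤ 1) : |g x - g y| ≤ chainConst β * A * |x - y| ^ β := by
  set r : ℝ := 2 ^ (-β) with hr
  have hr0 : 0 < r := by positivity
  have hr1 : r < 1 := Real.rpow_lt_one_of_one_lt_of_neg one_lt_two (neg_lt_zero.mpr hβ)
  have hA : 0 ≤ A := by simpa using (abs_nonneg _).trans (h 0 0)
  have happrox : ∀ (x : ℝ) (n : ℕ), |g (⌊2 ^ n * x⌋ / 2 ^ n) - g x| ≤ A * r ^ n / (1 - r) := by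
    intro x n
    refine dist_le_of_le_geometric_of_tendsto r A hr1 (fun m => ?_)
      ((hg.tendsto x).comp (tendsto_floor_two_pow_mul_div x)) n
    set k : ℤ := ⌊2 ^ m * x⌋ with hk
    have h2 : (2 : ℝ) ^ (m + 1) * x = 2 * (2 ^ m * x) := by ring
    have e1 : (k : ℝ) / 2 ^ m = ((2 * k : ℤ) : ℝ) / 2 ^ (m + 1) := by
      push_cast; rw [pow_succ]; field_simp
    have hk1 := Int.floor_le (2 ^ m * x)
    have hk2 := Int.lt_floor_add_one (2 ^ m * x)
    -- Hence consecutive approximations coincide or are the endpoints of a single interval of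
    -- generation `m + 1`.
    have hcase : ⌊2 ^ (m + 1) * x⌋ = 2 * k ∨ ⌊2 ^ (m + 1) * x⌋ = 2 * k + 1 := by
      have l1 : 2 * k ≤ ⌊2 ^ (m + 1) * x⌋ := by
        rw [Int.le_floor, h2]; push_cast; linarith
      have l2 : ⌊2 ^ (m + 1) * x⌋ < 2 * k + 2 := by
        rw [Int.floor_lt, h2]; push_cast; linarith
      omega
    simp only [Function.comp_apply]
    rcases hcase with hc | hc
    · rw [hc, ← e1, dist_self]; positivity
    · rw [hc, e1, dist_comm, Real.dist_eq, show (((2 * k + 1 : ℤ) : ℝ)) = ((2 * k : ℤ) : ℝ) + 1 by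
        push_cast; ring]
      refine (h (m + 1) (2 * k)).trans ?_
      exact mul_le_mul_of_nonneg_left (pow_le_pow_of_le_one hr0.le hr1.le (Nat.le_succ m)) hA
  wlog hle : x ≤ y generalizing x y
  · rw [abs_sub_comm (g x), abs_sub_comm x]
    exact this y x (by rwa [abs_sub_comm]) (le_of_not_ge hle)
  rcases eq_or_lt_of_le hle with rfl | hlt
  · simp [Real.zero_rpow hβ.ne']
  have hpos : 0 < |x - y| := abs_pos.mpr (sub_ne_zero.mpr hlt.ne)
  obtain ⟨n, hn1, hn2⟩ := exists_nat_pow_near_of_lt_one hpos hxy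
    (show (0 : ℝ) < 1 / 2 by norm_num) (by norm_num)
  have hp : (0 : ℝ) < 2 ^ n := by positivity
  have hmid : |g (⌊2 ^ n * y⌋ / 2 ^ n) - g (⌊2 ^ n * x⌋ / 2 ^ n)| ≤ A * r ^ n := by
    set k : ℤ := ⌊2 ^ n * x⌋ with hk
    have hd : 2 ^ n * y ≤ 2 ^ n * x + 1 := by
      have : y - x ≤ (1 / 2) ^ n := by rwa [abs_sub_comm, abs_of_pos (by linarith)] at hn2
      have h3 := mul_le_mul_of_nonneg_left this hp.le
      rw [← mul_pow] at h3
      norm_num at h3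
      linarith
    have hcase : ⌊2 ^ n * y⌋ = k ∨ ⌊2 ^ n * y⌋ = k + 1 := by
      have l1 : k ≤ ⌊2 ^ n * y⌋ := Int.floor_mono (mul_le_mul_of_nonneg_left hle hp.le)
      have l2 : ⌊2 ^ n * y⌋ < k + 2 := by
        rw [Int.floor_lt]; push_cast; linarith [Int.lt_floor_add_one (2 ^ n * x)]
      omega
    rcases hcase with hc | hc
    · rw [hc, sub_self, abs_zero]; positivity
    · rw [hc]; push_cast; exact h n k
  have hrn : r ^ n ≤ 2 ^ β * |x - y| ^ β := by
    rw [← Real.mul_rpow (by norm_num) hpos.le, hr, ← Real.rpow_natCast, ← Real.rpow_mul (by norm_num),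
      show (-β) * (n : ℝ) = (-(n : ℝ)) * β by ring, Real.rpow_mul (by norm_num)]
    refine Real.rpow_le_rpow (by positivity) ?_ hβ.le
    rw [Real.rpow_neg (by norm_num), Real.rpow_natCast, ← inv_pow]
    rw [pow_succ] at hn1
    norm_num at hn1 ⊢
    linarith
  have hx := happrox x n
  have hy := happrox y n
  have htri : |g x - g y| ≤ |g (⌊2 ^ n * x⌋ / 2 ^ n) - g x| +
      |g (⌊2 ^ n * y⌋ / 2 ^ n) - g (⌊2 ^ n * x⌋ / 2 ^ n)| + |g (⌊2 ^ n * y⌋ / 2 ^ n) - g y| := by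
    rw [show g x - g y = -(g (⌊2 ^ n * x⌋ / 2 ^ n) - g x) -
      (g (⌊2 ^ n * y⌋ / 2 ^ n) - g (⌊2 ^ n * x⌋ / 2 ^ n)) + (g (⌊2 ^ n * y⌋ / 2 ^ n) - g y) by ring]
    refine (abs_add_le _ _).trans (add_le_add_left ((abs_sub _ _).trans_eq (by rw [abs_neg])) _)
  have h1r : 0 < 1 - r := by linarith
  calc |g x - g y| ≤ A * r ^ n / (1 - r) + A * r ^ n + A * r ^ n / (1 - r) := by linarith
    _ = (2 / (1 - r) + 1) * A * r ^ n := by field_simp; ring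
    _ ≤ (2 / (1 - r) + 1) * A * (2 ^ β * |x - y| ^ β) := by gcongr
    _ = chainConst β * A * |x - y| ^ β := by rw [chainConst]; ring

/-! ### Square-integrated increments of the approximate Green's function -/

theorem log_one_add_le_rpow_div {t θ : ℝ} (ht : 0 ≤ t) (hθ : 0 < θ) (hθ1 : θ ≤ 1) :
    Real.log (1 + t) ≤ t ^ θ / θ := by
  have h1 : (1 + t) ^ θ ≤ 1 + t ^ θ := by
    simpa using Real.rpow_add_le_add_rpow zero_le_one ht hθ.le hθ1
  have h2 : θ * Real.log (1 + t) = Real.log ((1 + t) ^ θ) := by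
    rw [Real.log_rpow (by linarith)]
  have h3 : Real.log ((1 + t) ^ θ) ≤ t ^ θ := by
    have h4 := Real.log_le_sub_one_of_pos (x := (1 + t) ^ θ) (by positivity)
    linarith
  rw [le_div_iff₀ hθ]
  linarith

theorem abs_log_abs_sub_log_abs_le {θ : ℝ} (hθ : 0 < θ) (hθ1 : θ ≤ 1) {a b : ℝ} (ha : a ≠ 0)
    (hb : b ≠ 0) : |(Real.log |a| - Real.log |b|)| ≤
      1 / θ * |a - b| ^ θ * (|a| ^ (-θ) + |b| ^ (-θ)) := by
  wlog hle : |b| ≤ |a| generalizing a b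
  · rw [abs_sub_comm, abs_sub_comm a, add_comm]
    exact this hb ha (le_of_not_ge hle)
  have ha' : 0 < |a| := abs_pos.mpr ha
  have hb' : 0 < |b| := abs_pos.mpr hb
  rw [abs_of_nonneg (sub_nonneg.mpr (Real.log_le_log hb' hle)), ← Real.log_div ha'.ne' hb'.ne']
  -- With `|b|` the smaller modulus, the logarithm of the ratio is at most `log (1 + |a - b| /
  -- |b|)`.
  have h1 : |a| / |b| ≤ 1 + |a - b| / |b| := by
    rw [div_le_iff₀ hb', add_mul, div_mul_cancel₀ _ hb'.ne', one_mul]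
    have h := abs_add_le b (a - b)
    rwa [add_sub_cancel] at h
  have h2 := (Real.log_le_log (by positivity) h1).trans
    (log_one_add_le_rpow_div (t := |a - b| / |b|) (by positivity) hθ hθ1)
  refine h2.trans ?_
  rw [Real.div_rpow (abs_nonneg _) hb'.le, Real.rpow_neg hb'.le, div_div, div_eq_mul_inv, mul_inv]
  have h3 : 0 ≤ 1 / θ * |a - b| ^ θ * |a| ^ (-θ) := by positivity
  have e : |a - b| ^ θ * ((|b| ^ θ)⁻¹ * θ⁻¹) = 1 / θ * |a - b| ^ θ * (|b| ^ θ)⁻¹ := by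
    field_simp
  rw [e, mul_add]
  linarith

theorem integrableOn_abs_rpow {r : ℝ} (hr : -1 < r) (R : ℝ) :
    IntegrableOn (fun x : ℝ => |x| ^ r) (Icc (-R) R) := by
  have h1 : IntegrableOn (fun x : ℝ => |x| ^ r) (Ioc 0 R) := by
    rcases le_total 0 R with hR | hR
    · refine (((intervalIntegrable_iff_integrableOn_Ioc_of_le hR).mp
        (intervalIntegral.intervalIntegrable_rpow' hr)).congr_fun (fun x hx => ?_)
        measurableSet_Ioc)
      simp only [abs_of_pos hx.1]
    · rw [Ioc_eq_empty (by linarith)]; exact integrableOn_empty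
  have h2 : IntegrableOn (fun x : ℝ => |x| ^ r) (Ico (-R) 0) := by
    have h := h1.comp_neg
    simpa using h
  have h3 : IntegrableOn (fun x : ℝ => |x| ^ r) {0} := by
    rw [integrableOn_singleton_iff]
    exact Or.inr (by simp)
  refine ((h1.union h2).union h3).mono_set fun x hx => ?_
  rcases lt_trichotomy x 0 with h | h | h
  · exact Or.inl (Or.inr ⟨hx.1, h⟩)
  · exact Or.inr h
  · exact Or.inl (Or.inl ⟨h, hx.2⟩)

namespace IsApproxGreen

variable {G : ℝ → ℝ}

theorem eq_zero (hG : IsApproxGreen G) {x : ℝ} (hx : 1 < |x|) : G x = 0 := by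
  refine image_eq_zero_of_notMem_tsupport fun h => ?_
  exact absurd (abs_le.mpr (hG.support h)) (not_le.mpr hx)

/-- In the coordinate `t = log |x|` the function `G` is `C¹`, has slope `1 / π` for `t < -1` and
vanishes for `t > 1`, so its derivative is bounded. Evenness covers negative arguments. -/
theorem exists_lipschitz_log (hG : IsApproxGreen G) : ∃ C, 0 ≤ C ∧ ∀ a b, a ≠ 0 → b ≠ 0 →
    |G a - G b| ≤ C * |(Real.log |a| - Real.log |b|)| := by
  set w : ℝ → ℝ := fun t => G (Real.exp t) with hw
  have hws : ContDiff ℝ 1 w :=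
    (hG.smooth.of_le (by exact_mod_cast le_top)).comp_contDiff Real.contDiff_exp
      fun x => (Real.exp_pos x).ne'
  have hd : Continuous (deriv w) := hws.continuous_deriv le_rfl
  obtain ⟨M, hM⟩ := (isCompact_Icc (a := (-1 : ℝ)) (b := 1)).exists_bound_of_continuousOn
    hd.continuousOn
  have hleft : ∀ t < (-1 : ℝ), deriv w t = 1 / Real.pi := by
    intro t ht
    have he : w =ᶠ[𝓝 t] fun t => 1 / Real.pi * t := by
      filter_upwards [Iio_mem_nhds ht] with s hs
      have h1 : Real.exp s ≤ 1 / 2 := by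
        refine (Real.exp_le_exp.mpr (le_of_lt hs)).trans ?_
        rw [Real.exp_neg, one_div]
        exact inv_anti₀ two_pos (by linarith [Real.add_one_le_exp (1 : ℝ)])
      rw [hw]
      simp only
      rw [hG.log _ (Real.exp_pos s).ne' (by rwa [abs_of_pos (Real.exp_pos s)]),
        abs_of_pos (Real.exp_pos s), Real.log_exp]
    rw [he.deriv_eq, deriv_const_mul_field, deriv_id'', mul_one]
  have hright : ∀ t > (1 : ℝ), deriv w t = 0 := by
    intro t ht
    have he : w =ᶠ[𝓝 t] fun _ => 0 := by
      filter_upwards [Ioi_mem_nhds ht] with s hs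
      refine hG.eq_zero ?_
      rw [abs_of_pos (Real.exp_pos s)]
      exact Real.one_lt_exp_iff.mpr (by linarith [show (1 : ℝ) < s from hs])
    rw [he.deriv_eq, deriv_const]
  set C := max M (1 / Real.pi) with hC
  have hC0 : 0 ≤ C := le_max_of_le_right (by positivity)
  have hbd : ∀ t, ‖deriv w t‖ ≤ C := by
    intro t
    rcases lt_or_ge t (-1) with h | h
    · rw [hleft t h, Real.norm_of_nonneg (by positivity)]; exact le_max_right _ _
    · rcases le_or_gt t 1 with h' | h'
      · exact (hM t ⟨h, h'⟩).trans (le_max_left _ _)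
      · rw [hright t h', norm_zero]; exact hC0
  refine ⟨C, hC0, fun a b ha hb => ?_⟩
  have h := convex_univ.norm_image_sub_le_of_norm_deriv_le
    (f := w) (fun x _ => (hws.differentiable one_ne_zero) x) (fun x _ => hbd x)
    (mem_univ (Real.log |b|)) (mem_univ (Real.log |a|))
  have hGabs : ∀ x, x ≠ 0 → w (Real.log |x|) = G x := by
    intro x hx
    rw [hw]
    simp only [Real.exp_log (abs_pos.mpr hx)]
    rcases abs_choice x with h | h
    · rw [h]
    · rw [h, hG.even]
  rw [hGabs a ha, hGabs b hb] at h
  simpa using h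

theorem exists_sq_increment_bound (hG : IsApproxGreen G) {θ : ℝ} (hθ : 0 < θ) (hθ1 : θ ≤ 1) :
    ∃ C, 0 ≤ C ∧ ∀ a b, a ≠ 0 → b ≠ 0 →
      (G a - G b) ^ 2 ≤ C * |a - b| ^ (2 * θ) * (|a| ^ (-(2 * θ)) + |b| ^ (-(2 * θ))) := by
  obtain ⟨C, hC, h⟩ := hG.exists_lipschitz_log
  refine ⟨2 * (C * (1 / θ)) ^ 2, by positivity, fun a b ha hb => ?_⟩
  have h1 := (h a b ha hb).trans
    (mul_le_mul_of_nonneg_left (abs_log_abs_sub_log_abs_le hθ hθ1 ha hb) hC)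
  have h2 := pow_le_pow_left₀ (abs_nonneg _) h1 2
  rw [sq_abs] at h2
  have e : ∀ (t s : ℝ), 0 ≤ t → t ^ (2 * s) = (t ^ s) ^ 2 := fun t s ht => by
    rw [mul_comm, Real.rpow_mul ht]; norm_cast
  rw [show -(2 * θ) = 2 * (-θ) by ring, e _ _ (abs_nonneg _), e _ _ (abs_nonneg _),
    e _ _ (abs_nonneg _)]
  refine h2.trans ?_
  have h3 : (|a| ^ (-θ) + |b| ^ (-θ)) ^ 2 ≤ 2 * ((|a| ^ (-θ)) ^ 2 + (|b| ^ (-θ)) ^ 2) := by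
    nlinarith [sq_nonneg (|a| ^ (-θ) - |b| ^ (-θ))]
  calc (C * (1 / θ * |a - b| ^ θ * (|a| ^ (-θ) + |b| ^ (-θ)))) ^ 2
      = (C * (1 / θ)) ^ 2 * (|a - b| ^ θ) ^ 2 * (|a| ^ (-θ) + |b| ^ (-θ)) ^ 2 := by ring
    _ ≤ (C * (1 / θ)) ^ 2 * (|a - b| ^ θ) ^ 2 *
        (2 * ((|a| ^ (-θ)) ^ 2 + (|b| ^ (-θ)) ^ 2)) := by gcongr
    _ = _ := by ring

/-- The pointwise bound has singularities `|z| ^ (-2θ)` and `|z + h| ^ (-2θ)`, which are locally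
integrable exactly because `θ < 1/2`. -/
theorem exists_integral_sq_increment_le (hG : IsApproxGreen G) {θ : ℝ} (hθ : 0 < θ)
    (hθ1 : θ < 1 / 2) (M : ℝ) : ∃ C, 0 ≤ C ∧ ∀ h, |h| ≤ M →
      Integrable (fun z => (G (z + h) - G z) ^ 2) ∧
      ∫ z, (G (z + h) - G z) ^ 2 ≤ C * |h| ^ (2 * θ) := by
  obtain ⟨K, hK, hsq⟩ := hG.exists_sq_increment_bound hθ (by linarith)
  -- If `|z| ≤ M + 1`, both `z` and `z + h` lie in `[-R, R]`; otherwise both have modulus above one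
  -- and `G` vanishes at both.
  set R := 2 * M + 1 with hR
  set B : ℝ → ℝ := (Icc (-R) R).indicator fun x => |x| ^ (-(2 * θ)) with hB
  have hBi : Integrable B :=
    (integrableOn_abs_rpow (by linarith) R).integrable_indicator measurableSet_Icc
  have hB0 : ∀ x, 0 ≤ B x := fun x => indicator_nonneg (fun _ _ => by positivity) x
  refine ⟨K * (2 * ∫ x, B x), mul_nonneg hK (mul_nonneg zero_le_two (integral_nonneg hB0)),
    fun h hh => ?_⟩
  have hM : 0 ≤ M := (abs_nonneg h).trans hh
  have hdom : ∀ᵐ z : ℝ, (G (z + h) - G z) ^ 2 ≤ K * |h| ^ (2 * θ) * (B (z + h) + B z) := by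
    have h1 : ∀ᵐ z : ℝ, z ≠ 0 := by simp [ae_iff]
    have h2 : ∀ᵐ z : ℝ, z ≠ -h := by simp [ae_iff]
    filter_upwards [h1, h2] with z hz1 hz2
    have hz2' : z + h ≠ 0 := fun h => hz2 (by linarith)
    by_cases hin : |z| ≤ M + 1
    · have hz : z ∈ Icc (-R) R := abs_le.mp (by linarith)
      have hzh : z + h ∈ Icc (-R) R := abs_le.mp ((abs_add_le _ _).trans (by linarith))
      rw [hB, indicator_of_mem hz, indicator_of_mem hzh]
      have := hsq (z + h) z hz2' hz1
      rwa [add_sub_cancel_left] at this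
    · push Not at hin
      have hz : 1 < |z| := by linarith
      have hzh : 1 < |z + h| := by
        have := abs_sub (z + h) h
        rw [add_sub_cancel_right] at this
        linarith
      rw [hG.eq_zero hz, hG.eq_zero hzh]
      have := hB0 z
      have := hB0 (z + h)
      simp only [sub_self, ne_eq, OfNat.ofNat_ne_zero, not_false_eq_true, zero_pow]
      positivity
  have hbi : Integrable fun z => K * |h| ^ (2 * θ) * (B (z + h) + B z) :=
    ((hBi.comp_add_right h).add hBi).const_mul _
  refine ⟨hbi.mono' ?_ (hdom.mono fun z hz => ?_), ?_⟩
  · exact ((hG.integrable.comp_add_right h).sub hG.integrable).aestronglyMeasurable.pow 2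
  · rwa [Real.norm_of_nonneg (sq_nonneg _)]
  · refine (integral_mono_of_nonneg (ae_of_all _ fun _ => sq_nonneg _) hbi hdom).trans_eq ?_
    rw [integral_const_mul, integral_add (hBi.comp_add_right h) hBi,
      integral_add_right_eq_self]
    ring

theorem integrable_sq (hG : IsApproxGreen G) : Integrable fun z => G z ^ 2 := by
  -- A shift by `3` separates the supports, so on the support of `G` the squared increment is `G ^
  -- 2`.
  obtain ⟨C, -, h⟩ := hG.exists_integral_sq_increment_le (θ := 1 / 4) (by norm_num) (by norm_num) 3
  refine (h 3 (by norm_num)).1.mono' (hG.integrable.aestronglyMeasurable.pow 2)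
    (ae_of_all _ fun z => ?_)
  rw [Real.norm_of_nonneg (sq_nonneg _)]
  rcases le_or_gt |z| 1 with hz | hz
  · rw [hG.eq_zero (x := z + 3) (by rw [lt_abs]; left; linarith [(abs_le.mp hz).1])]
    simp
  · rw [hG.eq_zero hz]
    simpa using sq_nonneg _

end IsApproxGreen

/-! ### Averaging does not increase the square integral -/

theorem integrable_mul_of_testFn (χ : TestFn) {f : ℝ → ℝ} (hf : Integrable f) (x : ℝ) :
    Integrable fun t => χ t * f (x - t) :=
  χ.hasCompactSupport.convolutionExists_left (L := ContinuousLinearMap.lsmul ℝ ℝ) χ.continuous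
    hf.locallyIntegrable x

/-- The variance of `t ↦ f (x - t)` under the probability density `χ` is nonnegative. -/
theorem sq_integral_mul_le {χ : TestFn} (hχ0 : ∀ x, 0 ≤ χ x) (hχ1 : ∫ x, χ x = 1) {f : ℝ → ℝ}
    (hf : Integrable f) (hf2 : Integrable fun x => f x ^ 2) (x : ℝ) :
    (∫ t, χ t * f (x - t)) ^ 2 ≤ ∫ t, χ t * f (x - t) ^ 2 := by
  set m := ∫ t, χ t * f (x - t) with hm
  have i1 := integrable_mul_of_testFn χ hf x
  have i2 := integrable_mul_of_testFn χ hf2 x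
  have h0 : 0 ≤ ∫ t, χ t * (f (x - t) - m) ^ 2 :=
    integral_nonneg fun t => mul_nonneg (hχ0 t) (sq_nonneg _)
  have h1 : ∫ t, χ t * (f (x - t) - m) ^ 2 = (∫ t, χ t * f (x - t) ^ 2) - m ^ 2 := by
    have e : (fun t => χ t * (f (x - t) - m) ^ 2) =
        fun t => χ t * f (x - t) ^ 2 - 2 * m * (χ t * f (x - t)) + m ^ 2 * χ t := by
      funext t; ring
    rw [e, integral_add (f := fun t => χ t * f (x - t) ^ 2 - 2 * m * (χ t * f (x - t)))
        (i2.sub (i1.const_mul _)) ((integrable_testFn χ).const_mul _),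
      integral_sub i2 (i1.const_mul _), integral_const_mul, integral_const_mul, hχ1, ← hm]
    ring
  linarith

theorem integral_sq_average_le {χ : TestFn} (hχ0 : ∀ x, 0 ≤ χ x) (hχ1 : ∫ x, χ x = 1)
    {f : ℝ → ℝ} (hf : Integrable f) (hf2 : Integrable fun x => f x ^ 2) :
    ∫ x, (∫ t, χ t * f (x - t)) ^ 2 ≤ ∫ x, f x ^ 2 := by
  have hi := (integrable_testFn χ).integrable_convolution (ContinuousLinearMap.lsmul ℝ ℝ) hf2
  have hint := integral_convolution (ContinuousLinearMap.lsmul ℝ ℝ) (integrable_testFn χ) hf2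
  rw [hχ1] at hint
  refine (integral_mono_of_nonneg (ae_of_all _ fun _ => sq_nonneg _) hi
    (ae_of_all _ fun x => sq_integral_mul_le hχ0 hχ1 hf hf2 x)).trans_eq ?_
  rw [hint]
  simp

/-! ### Commuting convolutions, and mollification of distributions -/

theorem convTest_comm {f g : ℝ → ℝ} (hf : Integrable f) (hcf : HasCompactSupport f)
    (hg : Integrable g) (hcg : HasCompactSupport g) (φ : TestFn) :
    convTest f hf hcf (convTest g hg hcg φ) = convTest g hg hcg (convTest f hf hcf φ) := by
  ext y
  simp only [convTest_apply, ← integral_const_mul]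
  obtain ⟨M, hM⟩ := φ.hasCompactSupport.exists_bound_of_continuous φ.continuous
  rw [integral_integral_swap]
  · refine integral_congr_ae (ae_of_all _ fun t => integral_congr_ae (ae_of_all _ fun s => ?_))
    simp only [sub_right_comm y s t]
    ring
  · have h1 : Integrable (fun z : ℝ × ℝ => φ (y - z.1 - z.2) * (f z.1 * g z.2))
        (volume.prod volume) :=
      (hf.mul_prod hg).bdd_mul (c := M)
        (φ.continuous.comp (by fun_prop)).aestronglyMeasurable (ae_of_all _ fun z => hM _)
    refine h1.congr (ae_of_all _ fun z => ?_)
    simp only [Function.uncurry]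
    ring

theorem convTest_testFn_comm (φ ψ : TestFn) :
    convTest φ (integrable_testFn φ) φ.hasCompactSupport ψ =
      convTest ψ (integrable_testFn ψ) ψ.hasCompactSupport φ := by
  ext y
  rw [convTest_apply, convTest_apply, ← integral_sub_left_eq_self _ volume y]
  simp only [sub_sub_cancel, mul_comm]

/-- Exchanging the mollifier with the test function makes the latter the weight of the
superposition, the form to which `distribution_convTest` applies. -/
theorem convTest_right_comm {f : ℝ → ℝ} (hf : Integrable f) (hc : HasCompactSupport f)
    (φ ψ : TestFn) :
    convTest φ (integrable_testFn φ) φ.hasCompactSupport (convTest f hf hc ψ) =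
      convTest ψ (integrable_testFn ψ) ψ.hasCompactSupport (convTest f hf hc φ) := by
  rw [convTest_comm, convTest_testFn_comm, convTest_comm]

/-- A sequence of smooth bumps shrinking to the origin. -/
def mollBump (n : ℕ) : ContDiffBump (0 : ℝ) :=
  ⟨1 / (2 * (n + 1)), 1 / (n + 1), by positivity, by
    rw [one_div_lt_one_div (by positivity) (by positivity)]
    have : (0 : ℝ) < n + 1 := by positivity
    linarith⟩

/-- A nonnegative approximate identity made of test functions. -/
def mollTest (n : ℕ) : TestFn :=
  ⟨(mollBump n).normed volume, (mollBump n).contDiff_normed, (mollBump n).hasCompactSupport_normed,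
    fun _ _ => trivial⟩

theorem mollTest_nonneg (n : ℕ) (x : ℝ) : 0 ≤ mollTest n x := (mollBump n).nonneg_normed x

theorem integral_mollTest (n : ℕ) : ∫ x, mollTest n x = 1 := (mollBump n).integral_normed

theorem mollTest_eq_zero (n : ℕ) {x : ℝ} (hx : 1 < |x|) : mollTest n x = 0 := by
  by_contra h
  have h1 : x ∈ Function.support ((mollBump n).normed volume) := h
  rw [ContDiffBump.support_normed_eq, mem_ball_zero_iff] at h1
  have h2 : (mollBump n).rOut ≤ 1 := by
    change (1 : ℝ) / (n + 1) ≤ 1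
    rw [div_le_one (by positivity)]
    linarith [n.cast_nonneg (α := ℝ)]
  rw [Real.norm_eq_abs] at h1
  linarith

/-- By superposition the left side averages the continuous function `x ↦ ξ (ψ (· - x))` over a
shrinking neighbourhood of the origin. -/
theorem tendsto_distribution_mollTest (ξ : 𝓓'((⊤ : Opens ℝ), ℝ)) (ψ : TestFn) :
    Tendsto (fun n => ξ (convTest (mollTest n) (integrable_testFn _)
      (mollTest n).hasCompactSupport ψ)) atTop (𝓝 (ξ ψ)) := by
  have hr : Tendsto (fun n => (mollBump n).rOut) atTop (𝓝 0) :=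
    tendsto_one_div_add_atTop_nhds_zero_nat
  have h := ContDiffBump.convolution_tendsto_right_of_continuous (μ := volume) hr
    ((continuous_distribution_shiftTest ξ ψ).comp continuous_neg) 0
  have e0 : shiftTest (-0) ψ = ψ := by ext y; simp
  simp only [Function.comp_apply, e0] at h
  refine h.congr fun n => ?_
  rw [distribution_convTest, convolution_def]
  refine integral_congr_ae (ae_of_all _ fun t => ?_)
  simp only [ContinuousLinearMap.lsmul_apply, smul_eq_mul, Function.comp_apply, zero_sub, neg_neg]
  rfl

/-! ### Moments of Gaussian random variables -/

/-- The even moments of the standard Gaussian distribution. -/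
def gaussMoment (m : ℕ) : ℝ≥0∞ := ∫⁻ x, ENNReal.ofReal ((x ^ 2) ^ m) ∂gaussianReal 0 1

theorem gaussMoment_ne_top (m : ℕ) : gaussMoment m ≠ ∞ := by
  have h := (memLp_id_gaussianReal (μ := 0) (v := 1) (2 * m : ℕ)).integrable_norm_pow'
  have h2 : Integrable (fun x : ℝ => (x ^ 2) ^ m) (gaussianReal 0 1) := by
    refine h.congr (ae_of_all _ fun x => ?_)
    simp [pow_mul]
  exact h2.lintegral_lt_top.ne

theorem HasGaussianLaw.lintegral_sq_pow {Ω : Type*} [MeasurableSpace Ω] {P : Measure Ω}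
    {X : Ω → ℝ} (hX : HasGaussianLaw X P) (h0 : ∫ ω, X ω ∂P = 0) (m : ℕ) :
    ∫⁻ ω, ENNReal.ofReal ((X ω ^ 2) ^ m) ∂P =
      ENNReal.ofReal ((∫ ω, X ω ^ 2 ∂P) ^ m) * gaussMoment m := by
  have hlaw := hX.map_eq_gaussianReal
  rw [h0, variance_of_integral_eq_zero hX.aemeasurable h0] at hlaw
  set V := ∫ ω, X ω ^ 2 ∂P with hV
  have hV0 : 0 ≤ V := integral_nonneg fun _ => sq_nonneg _
  have hscale : gaussianReal 0 V.toNNReal = (gaussianReal 0 1).map fun x => √V * x := by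
    rw [gaussianReal_map_const_mul]
    congr 1
    · simp
    · ext; simp [Real.sq_sqrt hV0, hV0]
  have hm : Measurable fun x : ℝ => ENNReal.ofReal ((x ^ 2) ^ m) := by fun_prop
  calc ∫⁻ ω, ENNReal.ofReal ((X ω ^ 2) ^ m) ∂P
      = ∫⁻ x, ENNReal.ofReal ((x ^ 2) ^ m) ∂(P.map X) :=
        (lintegral_map' hm.aemeasurable hX.aemeasurable).symm
    _ = ∫⁻ x, ENNReal.ofReal (((√V * x) ^ 2) ^ m) ∂gaussianReal 0 1 := by
        rw [hlaw, hscale, lintegral_map hm (by fun_prop)]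
    _ = ∫⁻ x, ENNReal.ofReal (V ^ m) * ENNReal.ofReal ((x ^ 2) ^ m) ∂gaussianReal 0 1 := by
        refine lintegral_congr fun x => ?_
        rw [← ENNReal.ofReal_mul (by positivity), mul_pow, Real.sq_sqrt hV0, mul_pow]
    _ = _ := lintegral_const_mul _ hm

/-! ### Second moments of periodic white noise -/

theorem integrable_testFn_mul (φ : TestFn) {g : ℝ → ℝ} (hg : Continuous g) :
    Integrable fun x => φ x * g x :=
  (φ.continuous.mul hg).integrable_of_hasCompactSupport φ.hasCompactSupport.mul_right

/-- The number of periods that a covariance of test functions of diameter `D` can see. -/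
def periodCount (L D : ℝ) : ℝ := 2 * ⌈D / L⌉₊ + 1

namespace IsPeriodicWhiteNoise

variable {Ω : Type*} [MeasurableSpace Ω] {P : Measure Ω} {L : ℝ} {ξ : Ω → 𝓓'((⊤ : Opens ℝ), ℝ)}

theorem hasGaussianLaw (hξ : IsPeriodicWhiteNoise P L ξ) (φ : TestFn) :
    HasGaussianLaw (fun ω => ξ ω φ) P := hξ.gaussian.hasGaussianLaw_eval φ

/-- Every shifted correlation is at most `∫ φ ^ 2`, and it vanishes once the shift `k * L` exceeds
the diameter `D` of the support. -/
theorem integral_sq_le (hξ : IsPeriodicWhiteNoise P L ξ) (hL : 0 < L) {φ : TestFn} {a D : ℝ}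
    (hφ : ∀ x, x ∉ Icc a (a + D) → φ x = 0) :
    ∫ ω, ξ ω φ ^ 2 ∂P ≤ periodCount L D * ∫ x, φ x ^ 2 := by
  have hi : Integrable fun x => φ x ^ 2 := by
    simpa [sq] using integrable_testFn_mul φ φ.continuous
  have hle : ∀ b : ℝ, ∫ x, φ x * φ (x + b) ≤ ∫ x, φ x ^ 2 := by
    intro b
    have h1 : Integrable fun x => (φ x ^ 2 + φ (x + b) ^ 2) / 2 :=
      (hi.add (hi.comp_add_right b)).div_const 2
    have h2 : ∫ x, (φ x ^ 2 + φ (x + b) ^ 2) / 2 = ∫ x, φ x ^ 2 := by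
      rw [integral_div, integral_add hi (hi.comp_add_right b),
        integral_add_right_eq_self (fun x => φ x ^ 2)]
      ring
    rw [← h2]
    refine integral_mono (integrable_testFn_mul φ (φ.continuous.comp (continuous_add_const b))) h1
      fun x => ?_
    simp only
    nlinarith [sq_nonneg (φ x - φ (x + b))]
  set n := ⌈D / L⌉₊ with hn
  have hzero : ∀ k : ℤ, k ∉ Finset.Icc (-(n : ℤ)) n → ∫ x, φ x * φ (x + k * L) = 0 := by
    intro k hk
    refine integral_eq_zero_of_ae (ae_of_all _ fun x => ?_)
    simp only [Pi.zero_apply, mul_eq_zero]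
    by_contra! hne
    have h1 : x ∈ Icc a (a + D) := by_contra fun h => hne.1 (hφ x h)
    have h2 : x + k * L ∈ Icc a (a + D) := by_contra fun h => hne.2 (hφ _ h)
    have h3 : D ≤ n * L := (div_le_iff₀ hL).mp (Nat.le_ceil (D / L))
    refine hk (Finset.mem_Icc.mpr ⟨?_, ?_⟩)
    · have : (-(n : ℝ)) * L ≤ k * L := by linarith [h1.2, h2.1]
      exact_mod_cast le_of_mul_le_mul_right this hL
    · have : (k : ℝ) * L ≤ n * L := by linarith [h1.1, h2.2]
      exact_mod_cast le_of_mul_le_mul_right this hL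
  calc ∫ ω, ξ ω φ ^ 2 ∂P = ∑' k : ℤ, ∫ x, φ x * φ (x + k * L) := by
        rw [← hξ.covariance φ φ]; simp only [sq]
    _ = ∑ k ∈ Finset.Icc (-(n : ℤ)) n, ∫ x, φ x * φ (x + k * L) := tsum_eq_sum hzero
    _ ≤ ∑ k ∈ Finset.Icc (-(n : ℤ)) n, ∫ x, φ x ^ 2 := Finset.sum_le_sum fun k _ => hle _
    _ = periodCount L D * ∫ x, φ x ^ 2 := by
        rw [Finset.sum_const, Int.card_Icc, nsmul_eq_mul, periodCount, ← hn]
        congr 1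
        have : ((n : ℤ) + 1 - -(n : ℤ)).toNat = 2 * n + 1 := by omega
        rw [this]
        push_cast
        ring

/-- Translating the integration variable and reindexing the periods shows that both variances and
the covariance are the same sum, so the difference has second moment zero. -/
theorem ae_shiftTest_period (hξ : IsPeriodicWhiteNoise P L ξ) (φ : TestFn) :
    ∀ᵐ ω ∂P, ξ ω (shiftTest L φ) = ξ ω φ := by
  have hX := hξ.hasGaussianLaw (shiftTest L φ)
  have hY := hξ.hasGaussianLaw φ
  set a : ℤ → ℝ := fun k => ∫ x, φ x * φ (x + k * L) with ha
  have cYY : ∫ ω, ξ ω φ * ξ ω φ ∂P = ∑' k, a k := hξ.covariance φ φ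
  have cXX : ∫ ω, ξ ω (shiftTest L φ) * ξ ω (shiftTest L φ) ∂P = ∑' k, a k := by
    rw [hξ.covariance]
    refine tsum_congr fun k => ?_
    rw [ha]
    simp only [shiftTest_apply]
    rw [← integral_sub_right_eq_self (fun x => φ x * φ (x + k * L)) L]
    simp only [sub_add_eq_add_sub]
  have cXY : ∫ ω, ξ ω (shiftTest L φ) * ξ ω φ ∂P = ∑' k, a k := by
    rw [hξ.covariance, ← (Equiv.subRight (1 : ℤ)).tsum_eq]
    refine tsum_congr fun k => ?_
    rw [ha]
    simp only [shiftTest_apply, Equiv.subRight_apply]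
    rw [← integral_sub_right_eq_self (fun x => φ x * φ (x + k * L)) L]
    refine integral_congr_ae (ae_of_all _ fun x => ?_)
    simp only
    congr 2
    push_cast
    ring
  have iXX : Integrable (fun ω => ξ ω (shiftTest L φ) * ξ ω (shiftTest L φ)) P :=
    hX.memLp_two.integrable_mul hX.memLp_two
  have iXY : Integrable (fun ω => ξ ω (shiftTest L φ) * ξ ω φ) P :=
    hX.memLp_two.integrable_mul hY.memLp_two
  have iYY : Integrable (fun ω => ξ ω φ * ξ ω φ) P := hY.memLp_two.integrable_mul hY.memLp_two
  have iXXY : Integrable (fun ω => ξ ω (shiftTest L φ) * ξ ω (shiftTest L φ) -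
      2 * (ξ ω (shiftTest L φ) * ξ ω φ)) P := iXX.sub (iXY.const_mul 2)
  have hz : ∫ ω, (ξ ω (shiftTest L φ) - ξ ω φ) ^ 2 ∂P = 0 := by
    have e : (fun ω => (ξ ω (shiftTest L φ) - ξ ω φ) ^ 2) = fun ω =>
        (ξ ω (shiftTest L φ) * ξ ω (shiftTest L φ) - 2 * (ξ ω (shiftTest L φ) * ξ ω φ)) +
          ξ ω φ * ξ ω φ := by funext ω; ring
    rw [e, integral_add iXXY iYY, integral_sub iXX (iXY.const_mul 2),
      integral_const_mul, cXX, cXY, cYY]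
    ring
  have hint : Integrable (fun ω => (ξ ω (shiftTest L φ) - ξ ω φ) ^ 2) P :=
    (hX.memLp_two.sub hY.memLp_two).integrable_sq
  rw [integral_eq_zero_iff_of_nonneg (fun _ => sq_nonneg _) hint] at hz
  filter_upwards [hz] with ω hω
  simpa [sub_eq_zero] using hω

end IsPeriodicWhiteNoise

/-! ### From dyadic increments of a periodic function to a Hölder bound -/

/-- The constant relating dyadic increments of an `L`-periodic function to its Hölder bound. -/
def periodicChainConst (β L : ℝ) : ℝ := (1 + chainConst β) * (1 + 2 * L ^ (-β))

theorem holderBound_of_periodic_dyadic {β L B : ℝ} (hβ : 0 < β) (hL : 0 < L) {s : ℝ → ℝ}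
    (hs : Continuous s) (hper : Function.Periodic s L) (h0 : |s 0| ≤ B)
    (h : ∀ (n : ℕ) (k : ℕ), k < 2 ^ n →
      |s (L * ((k + 1) / 2 ^ n)) - s (L * (k / 2 ^ n))| ≤ B * (2 ^ (-β)) ^ n) :
    HolderBound β (periodicChainConst β L * B) s := by
  set c := chainConst β with hc
  have hc0 : 0 ≤ c := chainConst_nonneg hβ
  have hB : 0 ≤ B := (abs_nonneg _).trans h0
  set g : ℝ → ℝ := fun t => s (L * t) with hg
  have hgc : Continuous g := hs.comp (continuous_const.mul continuous_id)
  have hgp : Function.Periodic g 1 := fun t => by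
    rw [hg]; simp only [mul_add, mul_one]; exact hper _
  -- Only intervals inside one period are controlled by assumption; reducing `k` modulo `2 ^ n`
  -- brings the others there.
  have hchain := abs_sub_le_of_dyadic (g := g) (A := B) hβ hgc (by
    intro n k
    have hk0 : 0 ≤ k % 2 ^ n := Int.emod_nonneg _ (by positivity)
    have hk1 : k % 2 ^ n < 2 ^ n := Int.emod_lt_of_pos _ (by positivity)
    obtain ⟨k', hk'⟩ := Int.eq_ofNat_of_zero_le hk0
    have hkd : (k : ℝ) = k' + 2 ^ n * (k / 2 ^ n : ℤ) := by
      have := Int.emod_add_mul_ediv k (2 ^ n)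
      rw [hk'] at this
      exact_mod_cast this.symm
    have hp : (0 : ℝ) < 2 ^ n := by positivity
    have e : ∀ t : ℝ, g ((t + 2 ^ n * (k / 2 ^ n : ℤ)) / 2 ^ n) = g (t / 2 ^ n) := by
      intro t
      rw [add_div, mul_div_cancel_left₀ _ hp.ne']
      simpa using (hgp.int_mul (k / 2 ^ n)) (t / 2 ^ n)
    have e2 : (k : ℝ) + 1 = (k' + 1) + 2 ^ n * (k / 2 ^ n : ℤ) := by rw [hkd]; ring
    rw [e2, e, hkd, e]
    refine h n k' ?_
    have : (k' : ℤ) < 2 ^ n := by rw [← hk']; exact hk1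
    exact_mod_cast this)
  have hgb : ∀ t, |g t| ≤ (1 + c) * B := by
    intro t
    have h1 : g t = g (Int.fract t) := by
      rw [Int.fract]
      have := (hgp.int_mul ⌊t⌋) (t - ⌊t⌋)
      simpa using this
    have hf0 := Int.fract_nonneg t
    have hf1 := (Int.fract_lt_one t).le
    have h2 := hchain (Int.fract t) 0 (by rw [sub_zero, abs_of_nonneg hf0]; exact hf1)
    rw [sub_zero, abs_of_nonneg hf0] at h2
    have h3 : Int.fract t ^ β ≤ 1 := Real.rpow_le_one hf0 hf1 hβ.le
    have h4 : |g 0| ≤ B := by simpa [hg] using h0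
    have h5 := abs_add_le (g (Int.fract t) - g 0) (g 0)
    rw [sub_add_cancel] at h5
    rw [h1]
    have h6 : c * B * Int.fract t ^ β ≤ c * B * 1 := by gcongr
    linarith
  have hsg : ∀ x, s x = g (x / L) := fun x => by
    rw [hg]; simp only [mul_div_cancel₀ _ hL.ne']
  have hLβ : 0 < L ^ (-β) := by positivity
  refine ⟨fun x => ?_, fun x y hxy => ?_⟩
  · rw [hsg]
    refine (hgb _).trans (mul_le_mul_of_nonneg_right ?_ hB)
    rw [periodicChainConst]
    nlinarith
  · have hd : (|x - y| / L) ^ β = L ^ (-β) * |x - y| ^ β := by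
      rw [Real.div_rpow (abs_nonneg _) hL.le, Real.rpow_neg hL.le]
      field_simp
    have hK : (c + 2 * (1 + c)) * L ^ (-β) * B * |x - y| ^ β ≥ 0 := by positivity
    -- When `L < 1`, points at distance at most one can be more than a period apart. The sup bound
    -- then suffices, as `(|x - y| / L) ^ β ≥ 1`.
    rcases le_or_gt |x - y| L with hle | hgt
    · have h1 := hchain (x / L) (y / L) (by
        rw [← sub_div, abs_div, abs_of_pos hL, div_le_one hL]; exact hle)
      rw [← sub_div, abs_div, abs_of_pos hL, hd, ← hsg, ← hsg] at h1
      refine h1.trans ?_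
      calc c * B * (L ^ (-β) * |x - y| ^ β) = (c * L ^ (-β)) * B * |x - y| ^ β := by ring
        _ ≤ periodicChainConst β L * B * |x - y| ^ β := by
          gcongr
          rw [periodicChainConst]
          nlinarith [mul_nonneg hc0 hLβ.le]
    · have h1 : 1 ≤ L ^ (-β) * |x - y| ^ β := by
        rw [← hd]
        exact Real.one_le_rpow ((one_le_div hL).mpr hgt.le) hβ.le
      have h2 : |s x - s y| ≤ 2 * (1 + c) * B := by
        rw [hsg x, hsg y]
        refine (abs_sub _ _).trans ?_
        linarith [hgb (x / L), hgb (y / L)]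
      refine h2.trans ?_
      calc 2 * (1 + c) * B = 2 * (1 + c) * B * 1 := by ring
        _ ≤ 2 * (1 + c) * B * (L ^ (-β) * |x - y| ^ β) := by gcongr
        _ = (2 * (1 + c) * L ^ (-β)) * B * |x - y| ^ β := by ring
        _ ≤ periodicChainConst β L * B * |x - y| ^ β := by
          gcongr
          rw [periodicChainConst]
          nlinarith

/-! ### The mollified field -/

section Field

variable {G : ℝ → ℝ}

theorem hasCompactSupport_comp_neg {f : ℝ → ℝ} (hf : HasCompactSupport f) :
    HasCompactSupport fun x => f (-x) := hf.comp_homeomorph (Homeomorph.neg ℝ)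

/-- The mollification of the approximate Green's function. -/
def greenTest (hG : IsApproxGreen G) (n : ℕ) : TestFn :=
  convTest (fun x => G (-x)) hG.integrable.comp_neg
    (hasCompactSupport_comp_neg hG.hasCompactSupport) (mollTest n)

theorem greenTest_apply (hG : IsApproxGreen G) (n : ℕ) (z : ℝ) :
    greenTest hG n z = ∫ t, mollTest n t * G (z - t) := by
  rw [greenTest, convTest_apply, ← integral_sub_left_eq_self _ volume z]
  simp only [sub_sub_cancel, hG.even, mul_comm]

theorem greenTest_eq_zero (hG : IsApproxGreen G) (n : ℕ) {z : ℝ} (hz : 2 < |z|) :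
    greenTest hG n z = 0 := by
  rw [greenTest_apply]
  refine integral_eq_zero_of_ae (ae_of_all _ fun t => ?_)
  rcases le_or_gt |t| 1 with h | h
  · have : 1 < |z - t| := by
      have := abs_add_le (z - t) t
      rw [sub_add_cancel] at this
      linarith
    simp [hG.eq_zero this]
  · simp [mollTest_eq_zero n h]

/-- The mollified field `x ↦ (-G * χₙ * T) x`. -/
def smoothField (hG : IsApproxGreen G) (n : ℕ) (T : 𝓓'((⊤ : Opens ℝ), ℝ)) (x : ℝ) : ℝ :=
  -T (shiftTest x (greenTest hG n))

theorem continuous_smoothField (hG : IsApproxGreen G) (n : ℕ) (T : 𝓓'((⊤ : Opens ℝ), ℝ)) :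
    Continuous (smoothField hG n T) := (continuous_distribution_shiftTest T _).neg

/-- The pairing equals `-T` applied to the mollification of the convolution of `φ` with the
reflected `G`, and that mollification may be removed in the limit. -/
theorem tendsto_integral_smoothField (hG : IsApproxGreen G) (T : 𝓓'((⊤ : Opens ℝ), ℝ))
    (φ : TestFn) : Tendsto (fun n => ∫ x, smoothField hG n T x * φ x) atTop
      (𝓝 (-convDistrib G hG.integrable hG.hasCompactSupport (fun ψ => T ψ) φ)) := by
  have h := (tendsto_distribution_mollTest T (convTest (fun x => G (-x)) hG.integrable.comp_neg
    (hasCompactSupport_comp_neg hG.hasCompactSupport) φ)).neg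
  refine h.congr fun n => ?_
  rw [convTest_right_comm, distribution_convTest, ← integral_neg]
  refine integral_congr_ae (ae_of_all _ fun x => ?_)
  simp only [smoothField, greenTest]
  ring

variable {Ω : Type*} [MeasurableSpace Ω] {P : Measure Ω} {L : ℝ} {ξ : Ω → 𝓓'((⊤ : Opens ℝ), ℝ)}

/-- The increment of the mollified `G` is the mollification of the increment, so Jensen yields a
bound independent of `n`. -/
theorem integral_sq_shiftTest_sub_le (hG : IsApproxGreen G) (n : ℕ) (x y : ℝ)
    (hq : Integrable fun z => (G (z + (y - x)) - G z) ^ 2) :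
    ∫ z, (shiftTest x (greenTest hG n) - shiftTest y (greenTest hG n) : TestFn) z ^ 2 ≤
      ∫ z, (G (z + (y - x)) - G z) ^ 2 := by
  have hf : Integrable fun z => G (z - x) - G (z - y) :=
    (hG.integrable.comp_sub_right x).sub (hG.integrable.comp_sub_right y)
  have e : ∀ z, (G (z - x) - G (z - y)) ^ 2 = (G ((z - y) + (y - x)) - G (z - y)) ^ 2 := by
    intro z; rw [sub_add_sub_cancel]
  have hf2 : Integrable fun z => (G (z - x) - G (z - y)) ^ 2 := by
    simp_rw [e]; exact hq.comp_sub_right y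
  have h := integral_sq_average_le (mollTest_nonneg n) (integral_mollTest n) hf hf2
  simp_rw [e] at h
  rw [integral_sub_right_eq_self (fun z => (G (z + (y - x)) - G z) ^ 2)] at h
  refine le_of_eq_of_le (integral_congr_ae (ae_of_all _ fun z => ?_)) h
  have h1 : (shiftTest x (greenTest hG n) - shiftTest y (greenTest hG n) : TestFn) z =
    greenTest hG n (z - x) - greenTest hG n (z - y) := rfl
  simp only [h1, greenTest_apply]
  rw [← integral_sub (integrable_mul_of_testFn _ hG.integrable _)
    (integrable_mul_of_testFn _ hG.integrable _)]
  congr 2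
  funext t
  rw [sub_right_comm z t x, sub_right_comm z t y]
  ring

theorem exists_integral_sq_smoothField_le (hξ : IsPeriodicWhiteNoise P L ξ) (hL : 0 < L)
    (hG : IsApproxGreen G) {θ : ℝ} (hθ : 0 < θ) (hθ1 : θ < 1 / 2) :
    ∃ K, 0 ≤ K ∧ (∀ n, ∫ ω, ξ ω (shiftTest 0 (greenTest hG n)) ^ 2 ∂P ≤ K) ∧
      ∀ n x y, |x - y| ≤ L → ∫ ω, ξ ω (shiftTest x (greenTest hG n) -
        shiftTest y (greenTest hG n)) ^ 2 ∂P ≤ K * |x - y| ^ (2 * θ) := by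
  obtain ⟨C, hC, hCb⟩ := hG.exists_integral_sq_increment_le hθ hθ1 L
  have hN : ∀ D, 0 ≤ periodCount L D := fun D => by unfold periodCount; positivity
  have hI : 0 ≤ ∫ z, G z ^ 2 := integral_nonneg fun _ => sq_nonneg _
  -- The mollified `G` lives in `[-2, 2]`, so one translate has diameter at most `4` and two
  -- translates at distance at most `L` span at most `L + 4`.
  refine ⟨periodCount L (L + 4) * C + periodCount L 4 * ∫ z, G z ^ 2,
    add_nonneg (mul_nonneg (hN _) hC) (mul_nonneg (hN _) hI), fun n => ?_, fun n x y hxy => ?_⟩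
  · refine (hξ.integral_sq_le hL (a := -2) (D := 4) fun z hz => ?_).trans ?_
    · rw [shiftTest_apply, sub_zero]
      refine greenTest_eq_zero hG n ?_
      by_contra! h
      exact hz ⟨(abs_le.mp h).1, by linarith [(abs_le.mp h).2]⟩
    · have h1 : ∫ z, shiftTest 0 (greenTest hG n) z ^ 2 ≤ ∫ z, G z ^ 2 := by
        refine le_of_eq_of_le (integral_congr_ae (ae_of_all _ fun z => ?_))
          (integral_sq_average_le (mollTest_nonneg n) (integral_mollTest n) hG.integrable
            hG.integrable_sq)
        simp only [shiftTest_apply, sub_zero, greenTest_apply]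
      have := mul_le_mul_of_nonneg_left h1 (hN 4)
      linarith [mul_nonneg (hN (L + 4)) hC]
  · have hyx : |y - x| ≤ L := by rwa [abs_sub_comm]
    refine (hξ.integral_sq_le hL (a := min x y - 2) (D := L + 4) fun z hz => ?_).trans ?_
    · have h1 : (shiftTest x (greenTest hG n) - shiftTest y (greenTest hG n) : TestFn) z =
        greenTest hG n (z - x) - greenTest hG n (z - y) := rfl
      have habs := abs_le.mp hxy
      have hfar : ∀ w, (w = x ∨ w = y) → 2 < |z - w| := by
        intro w hw
        by_contra! h
        have h' := abs_le.mp h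
        refine hz ⟨?_, ?_⟩
        · have : min x y ≤ w := by rcases hw with rfl | rfl <;> simp
          linarith
        · have : w ≤ min x y + L := by
            rcases hw with rfl | rfl <;> rw [min_def] <;> split_ifs <;> linarith
          linarith
      rw [h1, greenTest_eq_zero hG n (hfar x (Or.inl rfl)),
        greenTest_eq_zero hG n (hfar y (Or.inr rfl)), sub_zero]
    · have h2 := (integral_sq_shiftTest_sub_le hG n x y (hCb _ hyx).1).trans (hCb _ hyx).2
      refine (mul_le_mul_of_nonneg_left h2 (hN _)).trans ?_
      rw [abs_sub_comm y x, add_mul, mul_assoc]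
      have : 0 ≤ (periodCount L 4 * ∫ z, G z ^ 2) * |x - y| ^ (2 * θ) :=
        mul_nonneg (mul_nonneg (hN _) hI) (by positivity)
      linarith

theorem ae_periodic_smoothField (hξ : IsPeriodicWhiteNoise P L ξ) (hG : IsApproxGreen G) :
    ∀ᵐ ω ∂P, ∀ n, Function.Periodic (smoothField hG n (ξ ω)) L := by
  -- The null set depends on the test function, so only countably many translates are treated;
  -- continuity in `x` gives the rest.
  have h : ∀ᵐ ω ∂P, ∀ (n : ℕ) (q : ℚ), ξ ω (shiftTest L (shiftTest (q : ℝ) (greenTest hG n))) =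
      ξ ω (shiftTest (q : ℝ) (greenTest hG n)) := by
    rw [ae_all_iff]; intro n
    rw [ae_all_iff]; intro q
    exact hξ.ae_shiftTest_period _
  filter_upwards [h] with ω hω n
  have hcont := continuous_smoothField hG n (ξ ω)
  have heq := Rat.denseRange_cast (𝕜 := ℝ).equalizer (hcont.comp (continuous_add_const L)) hcont
    (by
      funext q
      simp only [Function.comp_apply, smoothField]
      rw [← hω n q]
      congr 2
      ext z
      simp [sub_sub, add_comm])
  exact fun x => congrFun heq x

end Field

/-! ### Kolmogorov's criterion for the field -/

section Kolmogorov

variable {G : ℝ → ℝ} {Ω : Type*} [MeasurableSpace Ω] {P : Measure Ω} {L : ℝ}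
  {ξ : Ω → 𝓓'((⊤ : Opens ℝ), ℝ)}

/-- The increment of the mollified field over the `k`-th dyadic interval of generation `j`,
normalised by the expected Hölder scaling. -/
def dyadicIncr (hG : IsApproxGreen G) (β L : ℝ) (n j k : ℕ) (T : 𝓓'((⊤ : Opens ℝ), ℝ)) : ℝ :=
  (2 ^ β) ^ j * (smoothField hG n T (L * ((k + 1) / 2 ^ j)) - smoothField hG n T (L * (k / 2 ^ j)))

/-- The sum of all even powers of normalised dyadic increments of the mollified field. -/
def dyadicEnergy (hG : IsApproxGreen G) (β L : ℝ) (m n : ℕ) (T : 𝓓'((⊤ : Opens ℝ), ℝ)) : ℝ≥0∞ :=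
  ENNReal.ofReal ((smoothField hG n T 0 ^ 2) ^ m) +
    ∑' j : ℕ, ∑ k ∈ Finset.range (2 ^ j), ENNReal.ofReal ((dyadicIncr hG β L n j k T ^ 2) ^ m)

theorem smoothField_sub (hG : IsApproxGreen G) (n : ℕ) (T : 𝓓'((⊤ : Opens ℝ), ℝ)) (x y : ℝ) :
    smoothField hG n T x - smoothField hG n T y =
      -T (shiftTest x (greenTest hG n) - shiftTest y (greenTest hG n)) := by
  rw [map_sub, smoothField, smoothField]; ring

theorem aemeasurable_smoothField (hξ : IsPeriodicWhiteNoise P L ξ) (hG : IsApproxGreen G) (n : ℕ)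
    (x : ℝ) : AEMeasurable (fun ω => smoothField hG n (ξ ω) x) P :=
  (hξ.hasGaussianLaw _).aemeasurable.neg

theorem aemeasurable_dyadicEnergy (hξ : IsPeriodicWhiteNoise P L ξ) (hG : IsApproxGreen G)
    (β : ℝ) (m n : ℕ) : AEMeasurable (fun ω => dyadicEnergy hG β L m n (ξ ω)) P := by
  have hm : ∀ {X : Ω → ℝ}, AEMeasurable X P →
      AEMeasurable (fun ω => ENNReal.ofReal ((X ω ^ 2) ^ m)) P :=
    fun hX => ((hX.pow_const 2).pow_const m).ennreal_ofReal
  refine (hm (aemeasurable_smoothField hξ hG n 0)).add (AEMeasurable.tsum fun j => ?_)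
  refine Finset.aemeasurable_fun_sum _ fun k _ => hm ?_
  exact ((aemeasurable_smoothField hξ hG n _).sub (aemeasurable_smoothField hξ hG n _)).const_mul _

theorem exists_lintegral_dyadicEnergy_le (hξ : IsPeriodicWhiteNoise P L ξ) (hL : 0 < L)
    (hG : IsApproxGreen G) {β : ℝ} (hβ : 0 < β) (hβ1 : β < 1 / 2) :
    ∃ m : ℕ, 1 ≤ m ∧ ∃ C : ℝ≥0∞, C ≠ ∞ ∧
      ∀ n, ∫⁻ ω, dyadicEnergy hG β L m n (ξ ω) ∂P ≤ C := by
  obtain ⟨θ, hθβ, hθ1⟩ := exists_between hβ1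
  have hθ : 0 < θ := hβ.trans hθβ
  -- Generation `j` has `2 ^ j` intervals, each contributing order `2 ^ (-2 * (θ - β) * m * j)`. The
  -- choice of `m` makes the ratio `r` of the resulting geometric series less than one.
  obtain ⟨m, hm⟩ := exists_nat_gt (1 / (2 * (θ - β)))
  have hθβ' : 0 < 2 * (θ - β) := by linarith
  have hm0 : (0 : ℝ) < m := (by positivity : (0 : ℝ) < 1 / (2 * (θ - β))).trans hm
  obtain ⟨K, hK, hK0, hKb⟩ := exists_integral_sq_smoothField_le hξ hL hG hθ hθ1
  set q : ℝ := 2 ^ (2 * β - 2 * θ) with hq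
  set r : ℝ := 2 * q ^ m with hr
  have hq0 : 0 < q := by positivity
  have hr0 : 0 < r := by positivity
  have hr1 : r < 1 := by
    have h1 : r = 2 ^ (1 + (2 * β - 2 * θ) * m) := by
      rw [hr, hq, Real.rpow_add two_pos, Real.rpow_one, Real.rpow_mul two_pos.le, Real.rpow_natCast]
    rw [h1]
    refine Real.rpow_lt_one_of_one_lt_of_neg one_lt_two ?_
    rw [div_lt_iff₀ hθβ'] at hm
    linarith
  have hmom : ∀ (φ : TestFn), ∫⁻ ω, ENNReal.ofReal ((ξ ω φ ^ 2) ^ m) ∂P =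
      ENNReal.ofReal ((∫ ω, ξ ω φ ^ 2 ∂P) ^ m) * gaussMoment m := fun φ =>
    HasGaussianLaw.lintegral_sq_pow (hξ.hasGaussianLaw φ) (hξ.centred φ) m
  set c : ℝ := (K * L ^ (2 * θ)) ^ m with hc
  refine ⟨m, by exact_mod_cast hm0, ENNReal.ofReal (K ^ m) * gaussMoment m +
    ENNReal.ofReal (c * (1 - r)⁻¹) * gaussMoment m, ?_, fun n => ?_⟩
  · exact ENNReal.add_ne_top.mpr ⟨ENNReal.mul_ne_top ENNReal.ofReal_ne_top (gaussMoment_ne_top m),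
      ENNReal.mul_ne_top ENNReal.ofReal_ne_top (gaussMoment_ne_top m)⟩
  have hmeas : ∀ {X : Ω → ℝ}, AEMeasurable X P →
      AEMeasurable (fun ω => ENNReal.ofReal ((X ω ^ 2) ^ m)) P :=
    fun hX => ((hX.pow_const 2).pow_const m).ennreal_ofReal
  have hdm : ∀ j k, AEMeasurable (fun ω => dyadicIncr hG β L n j k (ξ ω)) P := fun j k =>
    ((aemeasurable_smoothField hξ hG n _).sub (aemeasurable_smoothField hξ hG n _)).const_mul _
  unfold dyadicEnergy
  rw [lintegral_add_left' (hmeas (aemeasurable_smoothField hξ hG n 0)),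
    lintegral_tsum fun j => Finset.aemeasurable_fun_sum _ fun k _ => hmeas (hdm j k)]
  refine add_le_add ?_ ?_
  · simp only [smoothField, neg_sq]
    rw [hmom]
    gcongr
    exact hK0 n
  · have hterm : ∀ j k : ℕ, ∫⁻ ω, ENNReal.ofReal ((dyadicIncr hG β L n j k (ξ ω) ^ 2) ^ m) ∂P ≤
        ENNReal.ofReal (c * (q ^ m) ^ j) * gaussMoment m := by
      intro j k
      set x := L * ((k + 1) / 2 ^ j : ℝ) with hx
      set y := L * (k / 2 ^ j : ℝ) with hy
      have hp : (1 : ℝ) ≤ 2 ^ j := one_le_pow₀ one_le_two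
      have hxy : |x - y| = L / 2 ^ j := by
        rw [hx, hy, ← mul_sub, ← sub_div, add_sub_cancel_left, mul_one_div,
          abs_of_pos (by positivity)]
      have hV := hKb n x y (by rw [hxy]; exact div_le_self hL.le hp)
      rw [hxy] at hV
      set φ := shiftTest x (greenTest hG n) - shiftTest y (greenTest hG n) with hφ
      have e : ∀ ω, ENNReal.ofReal ((dyadicIncr hG β L n j k (ξ ω) ^ 2) ^ m) =
          ENNReal.ofReal (((((2 : ℝ) ^ β) ^ j) ^ 2) ^ m) * ENNReal.ofReal ((ξ ω φ ^ 2) ^ m) := by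
        intro ω
        rw [dyadicIncr, smoothField_sub, ← ENNReal.ofReal_mul (by positivity), mul_pow, mul_pow,
          neg_sq]
      simp_rw [e]
      rw [lintegral_const_mul'' _ (hmeas (hξ.hasGaussianLaw φ).aemeasurable), hmom, ← mul_assoc,
        ← ENNReal.ofReal_mul (by positivity)]
      gcongr ENNReal.ofReal ?_ * _
      refine (mul_le_mul_of_nonneg_left (pow_le_pow_left₀ (integral_nonneg fun _ => sq_nonneg _)
        hV m) (by positivity)).trans_eq ?_
      have e2 : (L / 2 ^ j) ^ (2 * θ) = L ^ (2 * θ) * (2 ^ (-(2 * θ))) ^ j := by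
        rw [Real.div_rpow hL.le (by positivity), div_eq_mul_inv, ← Real.rpow_neg (by positivity),
          ← Real.rpow_natCast, ← Real.rpow_natCast, ← Real.rpow_mul two_pos.le,
          ← Real.rpow_mul two_pos.le, mul_comm (j : ℝ)]
      have e3 : q = (2 ^ β) ^ 2 * 2 ^ (-(2 * θ)) := by
        rw [hq, ← Real.rpow_natCast, ← Real.rpow_mul two_pos.le, ← Real.rpow_add two_pos]
        congr 1
        push_cast
        ring
      rw [e2, hc, e3, ← pow_mul _ m j, mul_comm m j, pow_mul _ j m, ← mul_pow, ← mul_pow]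
      congr 1
      rw [mul_pow _ _ j]
      ring
    calc ∑' j : ℕ, ∫⁻ ω, ∑ k ∈ Finset.range (2 ^ j),
          ENNReal.ofReal ((dyadicIncr hG β L n j k (ξ ω) ^ 2) ^ m) ∂P
        ≤ ∑' j : ℕ, ENNReal.ofReal (c * r ^ j) * gaussMoment m := by
          refine ENNReal.tsum_le_tsum fun j => ?_
          rw [lintegral_finsetSum' _ fun k _ => hmeas (hdm j k)]
          refine (Finset.sum_le_sum fun k _ => hterm j k).trans_eq ?_
          rw [Finset.sum_const, Finset.card_range, nsmul_eq_mul, ← mul_assoc]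
          congr 1
          rw [← ENNReal.ofReal_natCast, ← ENNReal.ofReal_mul (by positivity)]
          congr 1
          rw [hr, mul_pow]
          push_cast
          ring
      _ = ENNReal.ofReal (c * (1 - r)⁻¹) * gaussMoment m := by
          rw [ENNReal.tsum_mul_right, ← ENNReal.ofReal_tsum_of_nonneg
            (fun j => by positivity) ((summable_geometric_of_lt_one hr0.le hr1).mul_left c),
            tsum_mul_left, tsum_geometric_of_lt_one hr0.le hr1]

/-- Each summand is at most the whole energy, and `|y| ≤ 1 + y ^ (2 * m)` since `m ≥ 1`. -/
theorem holderBound_of_dyadicEnergy_le (hL : 0 < L) (hG : IsApproxGreen G) {β : ℝ} (hβ : 0 < β)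
    {m n : ℕ} (hm : 1 ≤ m) {T : 𝓓'((⊤ : Opens ℝ), ℝ)}
    (hper : Function.Periodic (smoothField hG n T) L) {z : ℝ} (hz : 0 ≤ z)
    (h : dyadicEnergy hG β L m n T ≤ ENNReal.ofReal z) :
    HolderBound β (periodicChainConst β L * (1 + z)) (smoothField hG n T) := by
  have key : ∀ y : ℝ, ENNReal.ofReal ((y ^ 2) ^ m) ≤ ENNReal.ofReal z → |y| ≤ 1 + z := by
    intro y hy
    rw [ENNReal.ofReal_le_ofReal_iff hz] at hy
    rcases le_or_gt |y| 1 with h1 | h1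
    · linarith
    · have h2 : |y| ≤ (y ^ 2) ^ m := by
        rw [← sq_abs, ← pow_mul]
        exact le_self_pow₀ h1.le (by omega)
      linarith
  refine holderBound_of_periodic_dyadic hβ hL (continuous_smoothField hG n T) hper ?_
    fun j k hk => ?_
  · exact key _ (le_self_add.trans h)
  · have h1 : ENNReal.ofReal ((dyadicIncr hG β L n j k T ^ 2) ^ m) ≤ ENNReal.ofReal z := by
      refine le_trans ?_ (le_add_self.trans h)
      refine le_trans ?_ (ENNReal.le_tsum j)
      exact Finset.single_le_sum (f := fun k => ENNReal.ofReal ((dyadicIncr hG β L n j k T ^ 2) ^ m))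
        (fun _ _ => zero_le) (Finset.mem_range.mpr hk)
    have h2 := key _ h1
    rw [dyadicIncr, abs_mul, abs_of_pos (by positivity)] at h2
    rw [Real.rpow_neg two_pos.le, inv_pow, ← div_eq_mul_inv, le_div_iff₀ (by positivity), mul_comm]
    exact h2

/-- Almost surely, `-G * ξ` is given by a bounded Hölder function, and the Hölder bound is a random
variable. -/
theorem exists_holderBound_field (hξ : IsPeriodicWhiteNoise P L ξ) (hL : 0 < L)
    (hG : IsApproxGreen G) {β : ℝ} (hβ : 0 < β) (hβ1 : β < 1 / 2) :
    ∃ A : Ω → ℝ, AEMeasurable A P ∧ ∀ᵐ ω ∂P, ∃ s, HolderBound β (A ω) s ∧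
      ∀ φ, -convDistrib G hG.integrable hG.hasCompactSupport (fun ψ => ξ ω ψ) φ =
        ∫ x, s x * φ x := by
  obtain ⟨m, hm, C, hC, hE⟩ := exists_lintegral_dyadicEnergy_le hξ hL hG hβ hβ1
  have hmeas := fun n => aemeasurable_dyadicEnergy hξ hG β m n
  -- Fatou controls the expectation of the `liminf`, whereas a supremum over `n` would need a
  -- maximal estimate. Its finiteness still bounds infinitely many fields.
  set Z : Ω → ℝ≥0∞ := fun ω => liminf (fun n => dyadicEnergy hG β L m n (ξ ω)) atTop with hZ
  have hZm : AEMeasurable Z P := by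
    refine ⟨fun ω => liminf (fun n => (hmeas n).mk _ ω) atTop,
      Measurable.liminf fun n => (hmeas n).measurable_mk, ?_⟩
    filter_upwards [ae_all_iff.mpr fun n => (hmeas n).ae_eq_mk] with ω hω
    rw [hZ]
    simp only [hω]
  have hZfin : ∀ᵐ ω ∂P, Z ω < ∞ := by
    refine ae_lt_top' hZm (ne_top_of_le_ne_top hC ?_)
    refine (lintegral_liminf_le' hmeas).trans ?_
    exact liminf_le_of_frequently_le' (Frequently.of_forall hE)
  refine ⟨fun ω => periodicChainConst β L * (1 + ((Z ω).toReal + 1)),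
    ((hZm.ennreal_toReal.add_const 1).const_add 1).const_mul _, ?_⟩
  filter_upwards [hZfin, ae_periodic_smoothField hξ hG] with ω hω hper
  refine HolderBound.exists_of_tendsto_integral hβ
    (fun φ => tendsto_integral_smoothField hG (ξ ω) φ) ?_
  -- The added `1` makes the inequality strict, which is what produces infinitely many `n` below the
  -- threshold.
  have hlt : liminf (fun n => dyadicEnergy hG β L m n (ξ ω)) atTop <
      ENNReal.ofReal ((Z ω).toReal + 1) := by
    rw [ENNReal.ofReal_add ENNReal.toReal_nonneg zero_le_one, ENNReal.ofReal_toReal hω.ne,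
      ENNReal.ofReal_one]
    exact ENNReal.lt_add_right hω.ne one_ne_zero
  refine (frequently_lt_of_liminf_lt (by isBoundedDefault) hlt).mono fun n hn => ?_
  exact holderBound_of_dyadicEnergy_le hL hG hβ hm (hper n) (by positivity) hn.le

end Kolmogorov

/-! ### Mollifying a Hölder function -/

/-- The mollification `ρ_ε * s` for `ε > 0`, and `s` itself for `ε ≤ 0`. -/
def mollifyFun (ρ : TestFn) (s : ℝ → ℝ) (ε : ℝ) : ℝ → ℝ :=
  open Classical in if 0 < ε then fun x => ∫ t, rescale ρ ε t * s (x - t) else s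

theorem continuous_rescale (ρ : TestFn) (ε : ℝ) : Continuous (rescale ρ ε) :=
  continuous_const.mul (ρ.continuous.comp (continuous_const.mul continuous_id))

theorem integral_rescale (ρ : TestFn) {ε : ℝ} (hε : 0 < ε) : ∫ x, rescale ρ ε x = ∫ x, ρ x := by
  unfold rescale
  rw [integral_const_mul, Measure.integral_comp_mul_left (fun x => ρ x), inv_inv, abs_of_pos hε,
    smul_eq_mul, inv_mul_cancel_left₀ hε.ne']

theorem integral_abs_rescale (ρ : TestFn) {ε : ℝ} (hε : 0 < ε) :
    ∫ x, |rescale ρ ε x| = ∫ x, |ρ x| := by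
  unfold rescale
  simp only [abs_mul]
  rw [integral_const_mul, Measure.integral_comp_mul_left (fun x => |ρ x|), inv_inv, abs_of_pos hε,
    abs_of_pos (inv_pos.mpr hε), smul_eq_mul, inv_mul_cancel_left₀ hε.ne']

theorem integrable_rescale_mul (ρ : TestFn) {ε : ℝ} (hε : 0 < ε) {g : ℝ → ℝ} (hg : Continuous g) :
    Integrable fun t => rescale ρ ε t * g t :=
  ((continuous_rescale ρ ε).mul hg).integrable_of_hasCompactSupport
    (hasCompactSupport_rescale ρ hε).mul_right

theorem abs_integral_rescale_mul_le (ρ : TestFn) {ε : ℝ} (hε : 0 < ε) {g : ℝ → ℝ} {c : ℝ}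
    (hg : ∀ t, rescale ρ ε t ≠ 0 → |g t| ≤ c) :
    |∫ t, rescale ρ ε t * g t| ≤ (∫ x, |ρ x|) * c := by
  rw [← integral_abs_rescale ρ hε, ← integral_mul_const, ← Real.norm_eq_abs]
  refine norm_integral_le_of_norm_le ((integrable_rescale ρ hε).abs.mul_const c)
    (ae_of_all _ fun t => ?_)
  rw [Real.norm_eq_abs, abs_mul]
  by_cases h : rescale ρ ε t = 0
  · simp [h]
  · exact mul_le_mul_of_nonneg_left (hg t h) (abs_nonneg _)

theorem one_le_integral_abs {ρ : TestFn} (hρ : ∫ x, ρ x = 1) : 1 ≤ ∫ x, |ρ x| := by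
  rw [← hρ]
  exact integral_mono (integrable_testFn ρ) (integrable_testFn ρ).abs fun x => le_abs_self _

namespace HolderBound

variable {β A : ℝ} {s : ℝ → ℝ}

/-- As `ρ` may change sign, averaging costs the factor `∫ |ρ|`. It is at least one because `∫ ρ =
1`, so the same constant serves the unmollified case. -/
theorem mollifyFun {ρ : TestFn} (hρ : ∫ x, ρ x = 1) (hβ : 0 < β) (hs : HolderBound β A s) (ε : ℝ) :
    HolderBound β ((∫ x, |ρ x|) * A) (mollifyFun ρ s ε) := by
  have hc := hs.continuous hβ
  unfold _root_.mollifyFun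
  split_ifs with hε
  · have hi : ∀ x, Integrable fun t => rescale ρ ε t * s (x - t) := fun x =>
      integrable_rescale_mul ρ hε (hc.comp (continuous_const.sub continuous_id))
    refine ⟨fun x => abs_integral_rescale_mul_le ρ hε fun t _ => hs.bound _, fun x y hxy => ?_⟩
    rw [← integral_sub (hi x) (hi y)]
    simp_rw [← mul_sub]
    rw [mul_assoc]
    refine abs_integral_rescale_mul_le ρ hε fun t _ => ?_
    have := hs.holder (x - t) (y - t)
    rw [sub_sub_sub_cancel_right] at this
    exact this hxy
  · exact hs.mono (le_mul_of_one_le_left hs.nonneg (one_le_integral_abs hρ))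

theorem abs_mollifyFun_sub_le {ρ : TestFn} (hρ : ∫ x, ρ x = 1) (hβ : 0 < β)
    (hs : HolderBound β A s) {R : ℝ} (hR : ∀ x, R < |x| → ρ x = 0) {ε : ℝ} (hε : 0 < ε)
    (hRε : R * ε ≤ 1) (x : ℝ) :
    |_root_.mollifyFun ρ s ε x - s x| ≤ (∫ x, |ρ x|) * (A * (R * ε) ^ β) := by
  have hc := hs.continuous hβ
  rw [_root_.mollifyFun, if_pos hε]
  have h1 : s x = ∫ t, rescale ρ ε t * s x := by
    rw [integral_mul_const, integral_rescale ρ hε, hρ, one_mul]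
  have h2 : (∫ t, rescale ρ ε t * s (x - t)) - s x =
      ∫ t, rescale ρ ε t * (s (x - t) - s x) := by
    have hi : Integrable fun t => rescale ρ ε t * s (x - t) :=
      integrable_rescale_mul ρ hε (hc.comp (continuous_const.sub continuous_id))
    have hi' : Integrable fun t => rescale ρ ε t * s x :=
      integrable_rescale_mul ρ hε continuous_const
    conv_lhs => rw [h1]
    rw [← integral_sub hi hi']
    simp_rw [← mul_sub]
  rw [h2]
  refine abs_integral_rescale_mul_le ρ hε fun t ht => ?_
  have ht' : |t| ≤ R * ε := by
    by_contra! h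
    refine ht ?_
    rw [rescale, hR, mul_zero]
    rw [abs_mul, abs_of_pos (inv_pos.mpr hε), inv_mul_eq_div, lt_div_iff₀ hε]
    exact h
  have h3 : |x - t - x| = |t| := by rw [sub_sub_cancel_left, abs_neg]
  refine (hs.holder (x - t) x (by rw [h3]; linarith)).trans ?_
  rw [h3]
  exact mul_le_mul_of_nonneg_left (Real.rpow_le_rpow (abs_nonneg _) ht' hβ.le) hs.nonneg

theorem integral_mollifyFun_mul {ρ : TestFn} (hβ : 0 < β) (hs : HolderBound β A s) {ε : ℝ}
    (hε : 0 < ε) (φ : TestFn) :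
    ∫ x, s x * convTest (fun x => rescale ρ ε (-x)) (integrable_rescale ρ hε).comp_neg
      (hasCompactSupport_comp_neg (hasCompactSupport_rescale ρ hε)) φ x =
      ∫ x, _root_.mollifyFun ρ s ε x * φ x := by
  have hc := hs.continuous hβ
  have hr := integrable_rescale ρ hε
  have hA : ∀ x, ‖s x‖ ≤ A := hs.bound
  calc ∫ x, s x * convTest (fun x => rescale ρ ε (-x)) hr.comp_neg _ φ x
      = ∫ x, ∫ t, s x * (rescale ρ ε (-t) * φ (x - t)) := by
        simp only [convTest_apply, integral_const_mul]
    _ = ∫ t, ∫ x, s x * (rescale ρ ε (-t) * φ (x - t)) := by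
        refine integral_integral_swap ?_
        have h := hr.comp_neg.convolution_integrand (ContinuousLinearMap.lsmul ℝ ℝ)
          (integrable_testFn φ)
        exact h.bdd_mul (c := A) (hc.comp continuous_fst).aestronglyMeasurable
          (ae_of_all _ fun z => hA _)
    _ = ∫ t, ∫ x, s (x + t) * (rescale ρ ε (-t) * φ x) := by
        refine integral_congr_ae (ae_of_all _ fun t => ?_)
        simp only
        rw [← integral_add_right_eq_self (fun x => s x * (rescale ρ ε (-t) * φ (x - t))) t]
        simp only [add_sub_cancel_right]
    _ = ∫ t, ∫ x, s (x - t) * (rescale ρ ε t * φ x) := by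
        rw [← integral_neg_eq_self]
        simp only [neg_neg, ← sub_eq_add_neg]
    _ = ∫ x, ∫ t, s (x - t) * (rescale ρ ε t * φ x) := by
        refine integral_integral_swap ?_
        exact (hr.mul_prod (integrable_testFn φ)).bdd_mul (c := A)
          (hc.comp (continuous_snd.sub continuous_fst)).aestronglyMeasurable
          (ae_of_all _ fun z => hA _)
    _ = ∫ x, _root_.mollifyFun ρ s ε x * φ x := by
        refine integral_congr_ae (ae_of_all _ fun x => ?_)
        simp only
        rw [_root_.mollifyFun, if_pos hε, ← integral_mul_const]
        refine integral_congr_ae (ae_of_all _ fun t => ?_)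
        simp only
        ring

/-- Convolutions with `G` and `ρ_ε` commute on test functions, so the mollification falls on the
continuous path `s`. The representation at `ε = 0` thus yields all `ε` on one event. -/
theorem isGivenBy_distribS {G : ℝ → ℝ} (hG : IsApproxGreen G) {ρ : TestFn} (hρ : ∫ x, ρ x = 1)
    (hβ : 0 < β) (hs : HolderBound β A s) {T : 𝓓'((⊤ : Opens ℝ), ℝ)}
    (hT : ∀ φ, -convDistrib G hG.integrable hG.hasCompactSupport (fun ψ => T ψ) φ =
      ∫ x, s x * φ x) (ε : ℝ) :
    IsGivenBy (distribS hG ρ T ε) (_root_.mollifyFun ρ s ε) := by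
  refine ⟨(hs.mollifyFun hρ hβ ε).continuous hβ, fun φ => ?_⟩
  by_cases hε : 0 < ε
  · rw [← hs.integral_mollifyFun_mul hβ hε, ← hT, distribS, mollify, dif_pos hε]
    exact congrArg (fun ψ => -T ψ) (convTest_comm hG.integrable.comp_neg
      (hasCompactSupport_comp_neg hG.hasCompactSupport) (integrable_rescale ρ hε).comp_neg
      (hasCompactSupport_comp_neg (hasCompactSupport_rescale ρ hε)) φ).symm
  · rw [distribS, mollify, dif_neg hε, _root_.mollifyFun, if_neg hε]
    exact hT φ

end HolderBound

/-! ### Singular integral operators with Hölder kernels -/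

namespace HolderSpace

variable {α : ℝ}

theorem abs_apply_le (w : HolderSpace α) (x : ℝ) : |w x| ≤ ‖w‖ := by
  rw [norm_def]
  have h := Real.iSup_nonneg fun p : NearPairs => holderQuot_nonneg α w p.1
  linarith [le_ciSup w.2.1 x]

theorem abs_sub_le (w : HolderSpace α) {x y : ℝ} (hxy : |x - y| ≤ 1) :
    |w x - w y| ≤ ‖w‖ * |x - y| ^ α := by
  rcases eq_or_ne x y with rfl | hne
  · rw [sub_self, abs_zero]
    exact mul_nonneg (norm_nonneg _) (by positivity)
  have hpos : 0 < |x - y| ^ α := Real.rpow_pos_of_pos (abs_pos.mpr (sub_ne_zero.mpr hne)) _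
  rw [← div_le_iff₀ hpos, norm_def]
  have h1 : holderQuot α w (x, y) ≤ _ := le_ciSup w.2.2 (⟨(x, y), hxy⟩ : NearPairs)
  have h2 : 0 ≤ ⨆ x, |w x| := Real.iSup_nonneg fun _ => abs_nonneg _
  have h3 : holderQuot α w (x, y) = |w x - w y| / |x - y| ^ α := rfl
  linarith

theorem holderBound (w : HolderSpace α) : HolderBound α ‖w‖ w :=
  ⟨abs_apply_le w, fun _ _ h => abs_sub_le w h⟩

end HolderSpace

/-- An absolutely convergent integral is a principal value. -/
theorem hasPrincipalValue_of_integrable {g : ℝ → ℝ} (hg : Integrable g) (x : ℝ) :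
    HasPrincipalValue g x (∫ y, g y) := by
  refine ⟨fun δ _ => hg.integrableOn, ?_⟩
  have h1 : ∀ δ, ∫ y in (Icc (x - δ) (x + δ))ᶜ, g y =
      ∫ y, (Icc (x - δ) (x + δ))ᶜ.indicator g y := fun δ =>
    (integral_indicator measurableSet_Icc.compl).symm
  simp_rw [h1]
  refine tendsto_integral_filter_of_dominated_convergence (fun y => ‖g y‖)
    (Eventually.of_forall fun δ => hg.aestronglyMeasurable.indicator measurableSet_Icc.compl)
    (Eventually.of_forall fun δ => ae_of_all _ fun y => norm_indicator_le_norm_self _ _) hg.norm ?_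
  have hne : ∀ᵐ y : ℝ, y ≠ x := by simp [ae_iff]
  filter_upwards [hne] with y hy
  have hpos : 0 < |y - x| := abs_pos.mpr (sub_ne_zero.mpr hy)
  refine tendsto_const_nhds.congr' ?_
  filter_upwards [Ioo_mem_nhdsGT hpos] with δ hδ
  rw [indicator_of_mem]
  rintro ⟨h1, h2⟩
  have : |y - x| ≤ δ := abs_le.mpr ⟨by linarith, by linarith⟩
  linarith [hδ.2]

/-- `k` is bounded by `c * min 1 (|x - y| ^ γ)`. -/
def KernelBound (γ c : ℝ) (k : ℝ → ℝ → ℝ) : Prop :=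
  ∀ x y, |k x y| ≤ c * min 1 (|x - y| ^ γ)

/-- The integrable majorant of the singular integrals of order `p - 2` near the origin. -/
def singularMajorant (p u : ℝ) : ℝ :=
  (Icc (-1) 1).indicator (fun u => |u| ^ (p - 2)) u + 4 * (1 + u ^ 2)⁻¹

theorem singularMajorant_nonneg (p u : ℝ) : 0 ≤ singularMajorant p u :=
  add_nonneg (indicator_nonneg (fun _ _ => by positivity) u) (by positivity)

theorem integrable_singularMajorant {p : ℝ} (hp : 1 < p) : Integrable (singularMajorant p) :=
  ((integrableOn_abs_rpow (by linarith) 1).integrable_indicator measurableSet_Icc).add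
    (integrable_inv_one_add_sq.const_mul 4)

section Kernel

variable {α γ c : ℝ} {k : ℝ → ℝ → ℝ}

/-- The integrand of the singular integral operator with kernel `k`. -/
def singularIntegrand (k : ℝ → ℝ → ℝ) (w : ℝ → ℝ) (x y : ℝ) : ℝ :=
  k x y * (w y - w x) / (y - x) ^ 2

/-- Near the diagonal the Hölder exponents add; at distance above one only the boundedness of `k`
and `w` is used. The majorant depends on `y - x` alone, so its integral is uniform in `x`. -/
theorem KernelBound.abs_singularIntegrand_le (hk : KernelBound γ c k) (hc : 0 ≤ c)
    (w : HolderSpace α) (x y : ℝ) :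
    |singularIntegrand k w x y| ≤ c * ‖w‖ * singularMajorant (α + γ) (y - x) := by
  have hw0 := norm_nonneg w
  rcases eq_or_ne y x with rfl | hne
  · rw [singularIntegrand, sub_self, mul_zero, zero_div, abs_zero]
    exact mul_nonneg (mul_nonneg hc hw0) (singularMajorant_nonneg _ _)
  have hpos : 0 < |y - x| := abs_pos.mpr (sub_ne_zero.mpr hne)
  have hkxy := hk x y
  rw [abs_sub_comm x y] at hkxy
  rw [singularIntegrand, abs_div, abs_mul, abs_pow, div_le_iff₀ (by positivity), singularMajorant]
  rcases le_or_gt |y - x| 1 with hle | hgt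
  · have h1 : |k x y| ≤ c * |y - x| ^ γ :=
      hkxy.trans (mul_le_mul_of_nonneg_left (min_le_right _ _) hc)
    have h2 := w.abs_sub_le hle
    rw [indicator_of_mem (by exact abs_le.mp hle)]
    have e : |y - x| ^ (α + γ - 2) * |y - x| ^ 2 = |y - x| ^ γ * |y - x| ^ α := by
      rw [← Real.rpow_natCast, ← Real.rpow_add hpos, ← Real.rpow_add hpos]
      congr 1
      push_cast
      ring
    have h3 : |k x y| * |w y - w x| ≤ c * |y - x| ^ γ * (‖w‖ * |y - x| ^ α) := by gcongr
    have h4 : 0 ≤ c * ‖w‖ * (4 * (1 + (y - x) ^ 2)⁻¹) * |y - x| ^ 2 := by positivity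
    calc |k x y| * |w y - w x| ≤ c * ‖w‖ * (|y - x| ^ γ * |y - x| ^ α) := by linarith
      _ = c * ‖w‖ * (|y - x| ^ (α + γ - 2) * |y - x| ^ 2) := by rw [e]
      _ ≤ c * ‖w‖ * (|y - x| ^ (α + γ - 2) + 4 * (1 + (y - x) ^ 2)⁻¹) * |y - x| ^ 2 := by linarith
  · have h1 : |k x y| ≤ c := by
      refine hkxy.trans (mul_le_of_le_one_right hc (min_le_left _ _))
    have h2 : |w y - w x| ≤ 2 * ‖w‖ := by
      refine (abs_sub _ _).trans ?_
      linarith [w.abs_apply_le x, w.abs_apply_le y]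
    have h3 : |k x y| * |w y - w x| ≤ c * (2 * ‖w‖) := by gcongr
    -- The factor `4` in the majorant is fixed here: `u ^ 2 / (1 + u ^ 2) ≥ 1/2` for `|u| ≥ 1`.
    have h4 : 2 ≤ 4 * (1 + (y - x) ^ 2)⁻¹ * |y - x| ^ 2 := by
      rw [sq_abs, mul_assoc, inv_mul_eq_div, ← mul_div_assoc, le_div_iff₀ (by positivity)]
      have : 1 ≤ (y - x) ^ 2 := by rw [← sq_abs]; exact one_le_pow₀ hgt.le
      linarith
    have h6 : y - x ∉ Icc (-1 : ℝ) 1 := fun h => absurd (abs_le.mpr ⟨h.1, h.2⟩) (not_le.mpr hgt)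
    rw [indicator_of_notMem h6, zero_add]
    have h5 := mul_le_mul_of_nonneg_left h4 (mul_nonneg hc hw0)
    linarith

theorem measurable_singularIntegrand (hkc : Continuous (Function.uncurry k)) {w : ℝ → ℝ}
    (hw : Continuous w) : Measurable (Function.uncurry (singularIntegrand k w)) := by
  have h1 := hkc.measurable
  have h2 := hw.measurable
  exact (h1.mul ((h2.comp measurable_snd).sub (h2.comp measurable_fst))).div
    ((measurable_snd.sub measurable_fst).pow_const 2)

theorem KernelBound.integrable_singularIntegrand (hk : KernelBound γ c k) (hc : 0 ≤ c)
    (hkc : Continuous (Function.uncurry k)) (hα : 0 < α) (hαγ : 1 < α + γ) (w : HolderSpace α)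
    (x : ℝ) : Integrable (singularIntegrand k w x) := by
  have h1 := ((integrable_singularMajorant hαγ).comp_sub_right x).const_mul (c * ‖w‖)
  refine h1.mono' ?_ (ae_of_all _ fun y => hk.abs_singularIntegrand_le hc w x y)
  exact ((measurable_singularIntegrand hkc (w.holderBound.continuous hα)).comp
    measurable_prodMk_left).aestronglyMeasurable

/-- `T` is the singular integral operator with kernel `π⁻¹ k x y / (y - x) ^ 2`, acting on
increments. -/
def IsSingularOperator (k : ℝ → ℝ → ℝ)
    (T : HolderSpace α →L[ℝ] Lp ℝ ∞ (volume : Measure ℝ)) : Prop :=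
  ∀ w : HolderSpace α,
    (T w : ℝ → ℝ) =ᵐ[volume] fun x => 1 / Real.pi * ∫ y, singularIntegrand k w x y

theorem KernelBound.exists_isSingularOperator (hk : KernelBound γ c k) (hc : 0 ≤ c)
    (hkc : Continuous (Function.uncurry k)) (hα : 0 < α) (hαγ : 1 < α + γ) :
    ∃ T : HolderSpace α →L[ℝ] Lp ℝ ∞ (volume : Measure ℝ),
      ‖T‖ ≤ c * ∫ u, singularMajorant (α + γ) u ∧ IsSingularOperator k T := by
  set M := ∫ u, singularMajorant (α + γ) u with hM
  have hM0 : 0 ≤ M := integral_nonneg (singularMajorant_nonneg _)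
  set I : HolderSpace α → ℝ → ℝ := fun w x => 1 / Real.pi * ∫ y, singularIntegrand k w x y with hI
  have hint := fun w x => hk.integrable_singularIntegrand hc hkc hα hαγ w x
  have hbound : ∀ w x, ‖I w x‖ ≤ c * M * ‖w‖ := by
    intro w x
    have h1 : ‖∫ y, singularIntegrand k w x y‖ ≤ c * ‖w‖ * M := by
      have h2 := ((integrable_singularMajorant hαγ).comp_sub_right x).const_mul (c * ‖w‖)
      refine (norm_integral_le_of_norm_le h2
        (ae_of_all _ fun y => hk.abs_singularIntegrand_le hc w x y)).trans_eq ?_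
      rw [integral_const_mul, integral_sub_right_eq_self]
    rw [hI, norm_mul, Real.norm_of_nonneg (by positivity : (0 : ℝ) ≤ 1 / Real.pi)]
    have h3 : 1 / Real.pi ≤ 1 := by
      rw [div_le_one Real.pi_pos]; linarith [Real.pi_gt_three]
    calc 1 / Real.pi * ‖∫ y, singularIntegrand k w x y‖
        ≤ 1 * ‖∫ y, singularIntegrand k w x y‖ := by gcongr
      _ ≤ c * M * ‖w‖ := by linarith
  have hmeas : ∀ w, AEStronglyMeasurable (I w) volume := by
    intro w
    have h1 := (measurable_singularIntegrand hkc (w.holderBound.continuous hα)).stronglyMeasurable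
    exact (h1.integral_prod_right.const_mul _).aestronglyMeasurable
  have hmem : ∀ w, MemLp (I w) ∞ volume := fun w =>
    memLp_top_of_bound (hmeas w) (c * M * ‖w‖) (ae_of_all _ (hbound w))
  have hadd : ∀ w w', I (w + w') = I w + I w' := by
    intro w w'
    funext x
    simp only [hI, Pi.add_apply]
    rw [← mul_add, ← integral_add (hint w x) (hint w' x)]
    congr 2
    funext y
    have h : ∀ z, (w + w' : HolderSpace α) z = w z + w' z := fun z => rfl
    simp only [singularIntegrand, h]
    ring
  have hsmul : ∀ (a : ℝ) w, I (a • w) = a • I w := by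
    intro a w
    funext x
    simp only [hI, Pi.smul_apply, smul_eq_mul]
    rw [mul_left_comm, ← integral_const_mul a]
    congr 2
    funext y
    have h : ∀ z, (a • w : HolderSpace α) z = a * w z := fun z => rfl
    simp only [singularIntegrand, h]
    ring
  let T₀ : HolderSpace α →ₗ[ℝ] Lp ℝ ∞ (volume : Measure ℝ) :=
    { toFun := fun w => (hmem w).toLp (I w)
      map_add' := fun w w' => by
        rw [← MemLp.toLp_add]
        exact MemLp.toLp_congr _ _ (by rw [hadd])
      map_smul' := fun a w => by
        rw [RingHom.id_apply, ← MemLp.toLp_const_smul]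
        exact MemLp.toLp_congr _ _ (by rw [hsmul]) }
  have hT₀ : ∀ w, ‖T₀ w‖ ≤ c * M * ‖w‖ := by
    intro w
    have hcM : 0 ≤ c * M * ‖w‖ := mul_nonneg (mul_nonneg hc hM0) (norm_nonneg _)
    change ‖(hmem w).toLp (I w)‖ ≤ _
    rw [Lp.norm_toLp]
    refine ENNReal.toReal_le_of_le_ofReal hcM ?_
    rw [eLpNorm_exponent_top]
    exact eLpNormEssSup_le_of_ae_bound (ae_of_all _ (hbound w))
  exact ⟨T₀.mkContinuous (c * M) hT₀, T₀.mkContinuous_norm_le (mul_nonneg hc hM0) hT₀,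
    fun w => (hmem w).coeFn_toLp⟩

/-- The operator is linear in its kernel and determined by it almost everywhere, so the difference
is the operator of the difference kernel and inherits its norm bound. -/
theorem IsSingularOperator.norm_sub_le {k₁ k₂ : ℝ → ℝ → ℝ} {c₁ c₂ : ℝ} (hk₁ : KernelBound γ c₁ k₁)
    (hk₂ : KernelBound γ c₂ k₂) (hc₁ : 0 ≤ c₁) (hc₂ : 0 ≤ c₂)
    (hkc₁ : Continuous (Function.uncurry k₁)) (hkc₂ : Continuous (Function.uncurry k₂))
    (hk : KernelBound γ c fun x y => k₁ x y - k₂ x y) (hc : 0 ≤ c) (hα : 0 < α) (hαγ : 1 < α + γ)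
    {T₁ T₂ : HolderSpace α →L[ℝ] Lp ℝ ∞ (volume : Measure ℝ)}
    (h₁ : IsSingularOperator k₁ T₁) (h₂ : IsSingularOperator k₂ T₂) :
    ‖T₁ - T₂‖ ≤ c * ∫ u, singularMajorant (α + γ) u := by
  obtain ⟨T, hT, hTs⟩ := hk.exists_isSingularOperator hc (hkc₁.sub hkc₂) hα hαγ
  have : T₁ - T₂ = T := by
    ext1 w
    refine Lp.ext ?_
    rw [sub_apply]
    filter_upwards [Lp.coeFn_sub (T₁ w) (T₂ w), h₁ w, h₂ w, hTs w] with x e0 e1 e2 e3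
    rw [e0, Pi.sub_apply, e1, e2, e3, ← mul_sub,
      ← integral_sub (hk₁.integrable_singularIntegrand hc₁ hkc₁ hα hαγ w x)
        (hk₂.integrable_singularIntegrand hc₂ hkc₂ hα hαγ w x)]
    congr 2
    funext y
    simp only [singularIntegrand]
    ring
  rwa [this]

end Kernel

/-! ### The exponential kernel of a Hölder function -/

theorem abs_exp_sub_exp_le {a b B : ℝ} (ha : |a| ≤ B) (hb : |b| ≤ B) :
    |Real.exp a - Real.exp b| ≤ Real.exp B * |a - b| := by
  wlog hab : b ≤ a generalizing a b
  · rw [abs_sub_comm, abs_sub_comm a]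
    exact this hb ha (le_of_not_ge hab)
  rw [abs_of_nonneg (sub_nonneg.mpr (Real.exp_le_exp.mpr hab)), abs_of_nonneg (sub_nonneg.mpr hab)]
  have h1 : Real.exp b = Real.exp a * Real.exp (b - a) := by rw [← Real.exp_add]; ring_nf
  have h2 := Real.add_one_le_exp (b - a)
  have h3 : Real.exp a ≤ Real.exp B := Real.exp_le_exp.mpr ((le_abs_self a).trans ha)
  calc Real.exp a - Real.exp b = Real.exp a * (1 - Real.exp (b - a)) := by rw [h1]; ring
    _ ≤ Real.exp a * (a - b) :=
      mul_le_mul_of_nonneg_left (by linarith) (Real.exp_pos a).le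
    _ ≤ Real.exp B * (a - b) := mul_le_mul_of_nonneg_right h3 (sub_nonneg.mpr hab)

/-- The kernel `exp (s y - s x) - 1`. -/
def expKernel (s : ℝ → ℝ) (x y : ℝ) : ℝ := Real.exp (s y - s x) - 1

theorem continuous_expKernel {s : ℝ → ℝ} (hs : Continuous s) :
    Continuous (Function.uncurry (expKernel s)) :=
  ((hs.comp continuous_snd).sub (hs.comp continuous_fst)).rexp.sub continuous_const

namespace HolderBound

variable {β γ B : ℝ} {s s' : ℝ → ℝ}

theorem abs_sub_le (hs : HolderBound β B s) (x y : ℝ) : |s y - s x| ≤ 2 * B :=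
  (abs_sub _ _).trans (by linarith [hs.bound x, hs.bound y])

theorem abs_sub_le_min (hs : HolderBound β B s) (hγ : 0 < γ) (hγβ : γ ≤ β) (x y : ℝ) :
    |s y - s x| ≤ 2 * B * min 1 (|x - y| ^ γ) := by
  have hB := hs.nonneg
  rcases le_or_gt |x - y| 1 with h | h
  · rw [min_eq_right (Real.rpow_le_one (abs_nonneg _) h hγ.le), abs_sub_comm]
    have h1 : |x - y| ^ β ≤ |x - y| ^ γ :=
      Real.rpow_le_rpow_of_exponent_ge_of_imp (abs_nonneg _) h hγβ fun _ h' => absurd h' (hγ.trans_le hγβ).ne'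
    calc |s x - s y| ≤ B * |x - y| ^ β := hs.holder x y h
      _ ≤ B * |x - y| ^ γ := by gcongr
      _ ≤ 2 * B * |x - y| ^ γ := by gcongr; linarith
  · rw [min_eq_left (Real.one_le_rpow h.le hγ.le), mul_one]
    exact hs.abs_sub_le x y

theorem kernelBound_expKernel (hs : HolderBound β B s) (hγ : 0 < γ) (hγβ : γ ≤ β) :
    KernelBound γ (Real.exp (2 * B) * (2 * B)) (expKernel s) := by
  intro x y
  have h := abs_exp_sub_exp_le (hs.abs_sub_le x y) (b := 0) (by simpa using hs.nonneg)
  rw [Real.exp_zero, sub_zero] at h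
  rw [expKernel, mul_assoc (Real.exp _)]
  exact h.trans (by gcongr; exact hs.abs_sub_le_min hγ hγβ x y)

/-- Two Hölder functions at small uniform distance are close in a weaker Hölder norm. -/
theorem abs_sub_sub_le (hs : HolderBound β B s) (hs' : HolderBound β B s') (hγ : 0 < γ)
    (hγβ : γ ≤ β) {R ε : ℝ} (hR : 0 ≤ R) (hε : 0 < ε) (hε1 : ε ≤ 1)
    (hd : ∀ x, |s' x - s x| ≤ B * (R * ε) ^ β) (x y : ℝ) :
    |s' y - s' x - (s y - s x)| ≤
      2 * B * (1 + R ^ β) * ε ^ (β - γ) * min 1 (|x - y| ^ γ) := by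
  have hB := hs.nonneg
  have hRβ : 0 ≤ R ^ β := Real.rpow_nonneg hR _
  -- Below scale `ε` the two Hölder bounds suffice, with `|x - y| ^ (β - γ)` giving the small
  -- factor; above it the uniform distance does, with `ε ^ γ ≤ |x - y| ^ γ`.
  rcases le_or_gt |x - y| ε with h | h
  · have h1 := h.trans hε1
    rw [min_eq_right (Real.rpow_le_one (abs_nonneg _) h1 hγ.le)]
    have h2 : |x - y| ^ β = |x - y| ^ (β - γ) * |x - y| ^ γ := by
      rw [← Real.rpow_add_of_nonneg (abs_nonneg _) (sub_nonneg.mpr hγβ) hγ.le, sub_add_cancel]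
    have h3 : |x - y| ^ (β - γ) ≤ ε ^ (β - γ) :=
      Real.rpow_le_rpow (abs_nonneg _) h (sub_nonneg.mpr hγβ)
    have e : s' y - s' x - (s y - s x) = (s x - s y) - (s' x - s' y) := by ring
    calc |s' y - s' x - (s y - s x)| ≤ |s x - s y| + |s' x - s' y| := by rw [e]; exact abs_sub _ _
      _ ≤ B * |x - y| ^ β + B * |x - y| ^ β := add_le_add (hs.holder x y h1) (hs'.holder x y h1)
      _ = 2 * B * 1 * |x - y| ^ (β - γ) * |x - y| ^ γ := by rw [h2]; ring
      _ ≤ _ := by gcongr; linarith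
  · have h1 : ε ^ γ ≤ min 1 (|x - y| ^ γ) :=
      le_min (Real.rpow_le_one hε.le hε1 hγ.le) (Real.rpow_le_rpow hε.le h.le hγ.le)
    have e : s' y - s' x - (s y - s x) = (s' y - s y) - (s' x - s x) := by ring
    have h2 : (R * ε) ^ β = R ^ β * (ε ^ (β - γ) * ε ^ γ) := by
      rw [Real.mul_rpow hR hε.le, ← Real.rpow_add hε, sub_add_cancel]
    calc |s' y - s' x - (s y - s x)| ≤ |s' y - s y| + |s' x - s x| := by rw [e]; exact abs_sub _ _
      _ ≤ B * (R * ε) ^ β + B * (R * ε) ^ β := add_le_add (hd y) (hd x)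
      _ = 2 * B * R ^ β * ε ^ (β - γ) * ε ^ γ := by rw [h2]; ring
      _ ≤ _ := by gcongr; linarith

theorem kernelBound_expKernel_sub (hs : HolderBound β B s) (hs' : HolderBound β B s') (hγ : 0 < γ)
    (hγβ : γ ≤ β) {R ε : ℝ} (hR : 0 ≤ R) (hε : 0 < ε) (hε1 : ε ≤ 1)
    (hd : ∀ x, |s' x - s x| ≤ B * (R * ε) ^ β) :
    KernelBound γ (Real.exp (2 * B) * (2 * B * (1 + R ^ β)) * ε ^ (β - γ))
      fun x y => expKernel s' x y - expKernel s x y := by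
  intro x y
  have h := abs_exp_sub_exp_le (hs'.abs_sub_le x y) (hs.abs_sub_le x y)
  simp only [expKernel, sub_sub_sub_cancel_right]
  refine h.trans ((mul_le_mul_of_nonneg_left (hs.abs_sub_sub_le hs' hγ hγβ hR hε hε1 hd x y)
    (Real.exp_pos _).le).trans_eq ?_)
  ring

end HolderBound

theorem IsSingularOperator.isXiOperator {α γ c : ℝ} {s : ℝ → ℝ}
    {T : HolderSpace α →L[ℝ] Lp ℝ ∞ (volume : Measure ℝ)}
    (hT : IsSingularOperator (expKernel s) T) (hk : KernelBound γ c (expKernel s)) (hc : 0 ≤ c)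
    (hs : Continuous s) (hα : 0 < α) (hαγ : 1 < α + γ) : IsXiOperator s T := fun w =>
  ⟨fun x => ∫ y, singularIntegrand (expKernel s) w x y, fun x =>
    hasPrincipalValue_of_integrable
      (hk.integrable_singularIntegrand hc (continuous_expKernel hs) hα hαγ w x) x, hT w⟩

/-- Convergence in measure from an almost sure bound by a random constant times a null function. -/
theorem tendstoInMeasure_of_norm_sub_le {Ω E : Type*} [MeasurableSpace Ω] [SeminormedAddCommGroup E]
    {P : Measure Ω} [IsFiniteMeasure P] {X : ℝ → Ω → E} {Y : Ω → E} {F : Ω → ℝ}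
    (hF : AEMeasurable F P) {r : ℝ → ℝ} {l : Filter ℝ} [l.IsCountablyGenerated]
    (hr : Tendsto r l (𝓝 0))
    (h : ∀ᶠ ε in l, ∀ᵐ ω ∂P, ‖X ε ω - Y ω‖ ≤ F ω * r ε) : TendstoInMeasure P X l Y := by
  -- Only the scalar bound is measurable; nothing is assumed on `X`. The filter is countably
  -- generated, so almost sure convergence along sequences is enough.
  have h0 : TendstoInMeasure P (fun ε ω => F ω * r ε) l fun _ => (0 : ℝ) := by
    intro η hη
    refine tendsto_of_seq_tendsto fun u hu => ?_
    refine tendstoInMeasure_of_tendsto_ae (f := fun n ω => F ω * r (u n)) (g := fun _ => (0 : ℝ))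
      (fun n => (hF.mul_const _).aestronglyMeasurable) (ae_of_all _ fun ω => ?_) η hη
    simpa using (hr.comp hu).const_mul (F ω)
  intro η hη
  refine tendsto_of_tendsto_of_tendsto_of_le_of_le' tendsto_const_nhds (h0 η hη)
    (Eventually.of_forall fun _ => zero_le) ?_
  filter_upwards [h] with ε hε
  refine measure_mono_ae ?_
  filter_upwards [hε] with ω hω hmem
  refine le_trans (show η ≤ edist (X ε ω) (Y ω) from hmem) ?_
  rw [edist_dist, edist_dist, dist_eq_norm, Real.dist_0_eq_abs]
  exact ENNReal.ofReal_le_ofReal (hω.trans (le_abs_self _))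

end

/-! ### The random operators and their convergence in probability -/

theorem proposition5p10 {Ω : Type*} [MeasurableSpace Ω] (P : Measure Ω) [IsProbabilityMeasure P]
    (L : ℝ) (hL : 0 < L)
    (ξ : Ω → 𝓓'((⊤ : Opens ℝ), ℝ)) (hξ : IsPeriodicWhiteNoise P L ξ)
    (ρ : TestFn) (hρ : ∫ x, ρ x = 1)
    (G : ℝ → ℝ) (hG : IsApproxGreen G)
    (κ : ℝ) (hκ : 0 < κ) (hκ' : κ < 1 / 2) :
    ∃ Ξ : ℝ → Ω → (HolderSpace (1 / 2 + κ) →L[ℝ] Lp ℝ ∞ (volume : Measure ℝ)),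
      (∀ ε : ℝ, 0 ≤ ε → ∀ᵐ ω ∂P, ∃ s : ℝ → ℝ,
        IsGivenBy (distribS hG ρ (ξ ω) ε) s ∧ IsXiOperator s (Ξ ε ω)) ∧
      TendstoInMeasure P Ξ (𝓝[>] 0) (Ξ 0) := by
  -- These choices give `β < 1/2` for the field, `1/2 + κ + γ = 1 + κ / 4` for integrability, and
  -- the rate `β - γ = κ / 4`.
  set β : ℝ := 1 / 2 - κ / 2 with hβ_def
  set γ : ℝ := 1 / 2 - 3 * κ / 4 with hγ_def
  have hβ : 0 < β := by linarith
  have hγ : 0 < γ := by linarith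
  have hγβ : γ ≤ β := by linarith
  have hα : 0 < 1 / 2 + κ := by linarith
  have hαγ : 1 < 1 / 2 + κ + γ := by linarith
  obtain ⟨A, hAm, hA⟩ := exists_holderBound_field hξ hL hG hβ (by linarith)
  set N : ℝ := ∫ x, |ρ x| with hN
  have hN1 : 1 ≤ N := one_le_integral_abs hρ
  obtain ⟨R, hR0, hR⟩ : ∃ R : ℝ, 0 < R ∧ ∀ x, R < |x| → ρ x = 0 := by
    obtain ⟨R, hR0, hR⟩ := ρ.hasCompactSupport.exists_pos_le_norm
    exact ⟨R, hR0, fun x hx => hR x hx.le⟩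
  -- A path is selected for every `ω`, namely `0` where the field has no Hölder representative, so
  -- that one choice serves all `ε`.
  have hS : ∀ ω, ∃ s : ℝ → ℝ, (∃ s, HolderBound β (A ω) s ∧
      ∀ φ, -convDistrib G hG.integrable hG.hasCompactSupport (fun ψ => ξ ω ψ) φ =
        ∫ x, s x * φ x) → HolderBound β (A ω) s ∧
      ∀ φ, -convDistrib G hG.integrable hG.hasCompactSupport (fun ψ => ξ ω ψ) φ =
        ∫ x, s x * φ x := fun ω => by
    by_cases h : ∃ s, HolderBound β (A ω) s ∧
      ∀ φ, -convDistrib G hG.integrable hG.hasCompactSupport (fun ψ => ξ ω ψ) φ =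
        ∫ x, s x * φ x
    · exact h.imp fun s hs _ => hs
    · exact ⟨0, fun h' => absurd h' h⟩
  choose S hS using hS
  have hS' : ∀ᵐ ω ∂P, HolderBound β (A ω) (S ω) ∧
      ∀ φ, -convDistrib G hG.integrable hG.hasCompactSupport (fun ψ => ξ ω ψ) φ =
        ∫ x, S ω x * φ x := hA.mono hS
  have hK0 : ∀ {ω}, HolderBound β (A ω) (S ω) →
      0 ≤ Real.exp (2 * (N * A ω)) * (2 * (N * A ω)) := fun {ω} h => by
    have := h.nonneg
    positivity
  have hK : ∀ {ω}, HolderBound β (A ω) (S ω) → ∀ ε, KernelBound γ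
      (Real.exp (2 * (N * A ω)) * (2 * (N * A ω))) (expKernel (mollifyFun ρ (S ω) ε)) :=
    fun h ε => (h.mollifyFun hρ hβ ε).kernelBound_expKernel hγ hγβ
  have hC : ∀ {ω}, HolderBound β (A ω) (S ω) → ∀ ε, Continuous (mollifyFun ρ (S ω) ε) :=
    fun h ε => (h.mollifyFun hρ hβ ε).continuous hβ
  -- Off the good event the zero operator is used.
  have hΞ : ∀ (ε : ℝ) (ω : Ω), ∃ T : HolderSpace (1 / 2 + κ) →L[ℝ] Lp ℝ ∞ (volume : Measure ℝ),
      HolderBound β (A ω) (S ω) → IsSingularOperator (expKernel (mollifyFun ρ (S ω) ε)) T := by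
    intro ε ω
    by_cases h : HolderBound β (A ω) (S ω)
    · obtain ⟨T, -, hT⟩ := (hK h ε).exists_isSingularOperator (hK0 h)
        (continuous_expKernel (hC h ε)) hα hαγ
      exact ⟨T, fun _ => hT⟩
    · exact ⟨0, fun h' => absurd h' h⟩
  choose Ξ hΞ using hΞ
  refine ⟨Ξ, fun ε _ => ?_, ?_⟩
  · filter_upwards [hS'] with ω hω
    exact ⟨mollifyFun ρ (S ω) ε, hω.1.isGivenBy_distribS hG hρ hβ hω.2 ε,
      (hΞ ε ω hω.1).isXiOperator (hK hω.1 ε) (hK0 hω.1) (hC hω.1 ε) hα hαγ⟩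
  · set M := ∫ u, singularMajorant (1 / 2 + κ + γ) u with hM
    have hr : Tendsto (fun ε : ℝ => ε ^ (β - γ)) (𝓝[>] 0) (𝓝 0) := by
      have hβγ : 0 < β - γ := by linarith
      have := (Real.continuousAt_rpow_const 0 (β - γ) (Or.inr hβγ.le)).tendsto
      rw [Real.zero_rpow hβγ.ne'] at this
      exact this.mono_left nhdsWithin_le_nhds
    -- The random constant depends on `ω` only through `A ω`, so no measurability of the paths or
    -- operators is needed.
    have hFm : AEMeasurable
        (fun ω => Real.exp (2 * (N * A ω)) * (2 * (N * A ω) * (1 + R ^ β)) * M) P := by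
      have h1 : AEMeasurable (fun ω => 2 * (N * A ω)) P := (hAm.const_mul N).const_mul 2
      exact ((Real.measurable_exp.comp_aemeasurable h1).mul (h1.mul_const _)).mul_const _
    refine tendstoInMeasure_of_norm_sub_le hFm hr ?_
    have hsmall : ∀ᶠ ε : ℝ in 𝓝[>] 0, ε < min 1 R⁻¹ :=
      mem_nhdsWithin_of_mem_nhds (Iio_mem_nhds (lt_min one_pos (inv_pos.mpr hR0)))
    filter_upwards [hsmall, self_mem_nhdsWithin] with ε hε1 hε
    have hε : 0 < ε := hε
    have hRε : R * ε ≤ 1 := by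
      have h := (hε1.trans_le (min_le_right _ _)).le
      calc R * ε ≤ R * R⁻¹ := by gcongr
        _ = 1 := mul_inv_cancel₀ hR0.ne'
    filter_upwards [hS'] with ω hω
    have h := hω.1
    have hA0 := h.nonneg
    have h0 : mollifyFun ρ (S ω) 0 = S ω := if_neg (lt_irrefl 0)
    have hd : ∀ x, |mollifyFun ρ (S ω) ε x - mollifyFun ρ (S ω) 0 x| ≤ N * A ω * (R * ε) ^ β := by
      intro x
      rw [h0, mul_assoc]
      exact h.abs_mollifyFun_sub_le hρ hβ hR hε hRε x
    have hk := (h.mollifyFun hρ hβ 0).kernelBound_expKernel_sub (h.mollifyFun hρ hβ ε) hγ hγβ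
      hR0.le hε (hε1.trans_le (min_le_left _ _)).le hd
    refine (IsSingularOperator.norm_sub_le (hK h ε) (hK h 0) (hK0 h) (hK0 h)
      (continuous_expKernel (hC h ε)) (continuous_expKernel (hC h 0)) hk (by positivity) hα hαγ
      (hΞ ε ω h) (hΞ 0 ω h)).trans_eq ?_
    ring
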